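/- Let $p$ be a prime, let $K/\mathbb{Q}_p$ be a finite extension, and let $E/K$ be an elliptic curve with good reduction, given by a fixed minimal Weierstrass equation. Let $L/K$ be a finite Galois extension that is ramified, let $\mathcal{O}$ be the ring of integers of $L$ and $\mathfrak{P}$ its maximal ideal, and let $\tau\in\mathrm{Gal}(L/K)$ be in the inertia group of $L/K$, i.e. $\tau$ preserves $\mathcal{O}$ and acts trivially on $\mathcal{O}/\mathfrak{P}$. Let $E_1(L)\subset E(L)$ be the kernel of reduction, i.e. the set of points whose reduction modulo $\mathfrak{P}$ (with respect to the fixed equation) is the point at infinity $[0:1:0]$, and let $z=-x/y$, with $z(O)=0$. Then: (a) For every $P\in E(L)$, the point $(\tau-1)P=\tau(P)-P$ lies in $E_1(L)$. (b) For every $Q\in E_1(L)$, the point $[p](\tau-1)Q$ lies in $E_1(L)$ and $$z\bigl([p](\tau-1)Q\bigr)\in\bigl((\tau z(Q))^p-z(Q)^p\bigr)\mathcal{O}+p\,\mathcal{O}.$$ -/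

import Mathlib

open ValuativeRel

noncomputable section

namespace LocalCurve

section LocalField

variable (K L : Type*) [Field K] [Field L] [ValuativeRel K] [ValuativeRel L] [Algebra K L]

/-- `L/K` is ramified: the ramification index, that is the index of the value group of `K` in that
of `L`, is not one. -/
def IsRamified [ValuativeExtension K L] : Prop :=
  ¬ Function.Surjective (ValuativeExtension.mapValueGroupWithZero K L)

/-- The inertia group of `L/K`, as a subgroup of `Gal(L/K)`: the automorphisms that preserve the
valuation ring of `L` and act trivially on its residue field. -/
def inertiaGroup : Subgroup (L ≃ₐ[K] L) :=
  ((valuation L).valuationSubring.inertiaSubgroup K).map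
    ((valuation L).valuationSubring.decompositionSubgroup K).subtype

end LocalField

section Curve

variable {L : Type*} [Field L] [ValuativeRel L]

/-- The point `P` of a Weierstrass curve in the projective plane over `L` reduces to the point `q`
of the projective plane over the residue field: `P` has homogeneous coordinates `[v₀ : v₁ : v₂]`
in the valuation ring, at least one of them a unit, whose residues are homogeneous coordinates
of `q`. -/
def ReducesTo {W : WeierstrassCurve L} (P : W.toAffine.Point)
    (q : WeierstrassCurve.Projective.PointClass 𝓀[L]) : Prop :=
  ∃ v : Fin 3 → 𝒪[L], (∃ i, IsUnit (v i)) ∧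
    (⟦fun i ↦ (v i : L)⟧ : WeierstrassCurve.Projective.PointClass L) = P.toProjective.point ∧
    (⟦fun i ↦ IsLocalRing.residue 𝒪[L] (v i)⟧ :
      WeierstrassCurve.Projective.PointClass 𝓀[L]) = q

/-- The kernel of reduction `E₁(L)`: the points that reduce to the point at infinity `[0 : 1 : 0]`.
It is used for Weierstrass equations with coefficients in the valuation ring of `L`. -/
def kernelOfReduction (W : WeierstrassCurve L) : Set W.toAffine.Point :=
  {P | ReducesTo P ⟦![0, 1, 0]⟧}

/-- The parameter `z = -x/y`, with value `0` at the point at infinity. On the kernel of reduction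
`y` does not vanish at affine points. -/
def z {L : Type*} [Field L] {W : WeierstrassCurve L} : W.toAffine.Point → L
  | .zero => 0
  | .some x y _ => -x / y

end Curve

end LocalCurve

end

/-! Near the origin the curve is described by z = -x/y and w = -1/y. There the chord-tangent law is
given by formulas whose denominators are congruent to 1 modulo the maximal ideal, so `addParams`
makes sense over any local ring and commutes with ring maps. This takes the place of the formal
group.

(a) Inertia moves integral elements by elements of the maximal ideal, so P and τP have the same
reduction. If both are near the origin, so is their difference. Otherwise both have integral
coordinates, and an integral x-coordinate of τP - P would force the slope to be integral and both
partial derivatives to vanish in the residue field, against smoothness (`nearOrigin_sub_of_congr`).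

(b) Put D = τQ - Q. Addition is z(Q) + z(D) modulo z(D) times the maximal ideal
(`addParams_fst_sub_mem`), so z(D) divides and is divisible by τz(Q) - z(Q) (`sub_fst_dvd_fst` is
the half needed). The series of [p] has coefficients divisible by p below degree p
(`coeff_multSeries_mem`): it commutes with [m], so if c T^h is its lowest term modulo p, then (m^h -
m)c = 0, and a primitive root m makes m^h - m invertible for 2 ≤ h < p. Hence z([p]D) lies in
(z(D)^p) + (p), and (τz - z)^p is congruent to (τz)^p - z^p modulo p. -/

open ValuativeRel

noncomputable section

namespace LocalCurve

/-! ### The chord-tangent construction in the coordinates `z = -x/y`, `w = -1/y` -/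

section Chord

variable {R : Type*} [CommRing R] (W : WeierstrassCurve R)

/-- The Weierstrass equation in the coordinates `z = -x/y` and `w = -1/y`. -/
def ZWEquation (P : R × R) : Prop :=
  P.2 = P.1 ^ 3 + W.a₁ * P.1 * P.2 + W.a₂ * P.1 ^ 2 * P.2 + W.a₃ * P.2 ^ 2 +
    W.a₄ * P.1 * P.2 ^ 2 + W.a₆ * P.2 ^ 3

/-- The denominator of the slope of the chord through two points, or of the tangent. -/
def chordDen (P Q : R × R) : R :=
  1 - W.a₁ * P.1 - W.a₂ * P.1 ^ 2 - W.a₃ * (P.2 + Q.2) - W.a₄ * P.1 * (P.2 + Q.2) -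
    W.a₆ * (P.2 ^ 2 + P.2 * Q.2 + Q.2 ^ 2)

/-- The numerator of the slope of the chord through two points, or of the tangent. -/
def chordNum (P Q : R × R) : R :=
  P.1 ^ 2 + P.1 * Q.1 + Q.1 ^ 2 + W.a₁ * Q.2 + W.a₂ * (P.1 + Q.1) * Q.2 + W.a₄ * Q.2 ^ 2

/-- The slope of the chord through two points, or of the tangent. -/
def chordSlope (P Q : R × R) : R :=
  chordNum W P Q * Ring.inverse (chordDen W P Q)

/-- The intercept of the chord through two points, or of the tangent. -/
def chordIntercept (P Q : R × R) : R :=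
  P.2 - chordSlope W P Q * P.1

/-- The leading coefficient of the cubic that cuts out the intersection of the curve with
a line of slope `l`. -/
def cubicLead (l : R) : R :=
  1 + W.a₂ * l + W.a₄ * l ^ 2 + W.a₆ * l ^ 3

/-- The quadratic coefficient of the cubic that cuts out the intersection of the curve with
the line `w = l z + n`. -/
def cubicQuad (l n : R) : R :=
  W.a₁ * l + W.a₂ * n + W.a₃ * l ^ 2 + 2 * W.a₄ * l * n + 3 * W.a₆ * l ^ 2 * n

/-- The third point of intersection of the curve with the chord through two points. -/
def thirdPoint (P Q : R × R) : R × R :=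
  let z := -(P.1 + Q.1) - cubicQuad W (chordSlope W P Q) (chordIntercept W P Q) *
    Ring.inverse (cubicLead W (chordSlope W P Q))
  (z, chordSlope W P Q * z + chordIntercept W P Q)

/-- The denominator in the formula for the inverse of a point. -/
def negDen (P : R × R) : R :=
  1 - W.a₁ * P.1 - W.a₃ * P.2

/-- The inverse of a point. -/
def negParams (P : R × R) : R × R :=
  (-P.1 * Ring.inverse (negDen W P), -P.2 * Ring.inverse (negDen W P))

/-- The sum of two points. -/
def addParams (P Q : R × R) : R × R :=
  negParams W (thirdPoint W P Q)

/-- The multiples of a point. -/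
def nsmulParams (P : R × R) : ℕ → R × R
  | 0 => 0
  | n + 1 => addParams W (nsmulParams P n) P

variable {W} {P Q : R × R}

/-- All denominators in the formula for the sum of two points are invertible. -/
structure Addable (W : WeierstrassCurve R) (P Q : R × R) : Prop where
  den : IsUnit (chordDen W P Q)
  lead : IsUnit (cubicLead W (chordSlope W P Q))
  neg : IsUnit (negDen W (thirdPoint W P Q))

lemma chordSlope_mul_chordDen (h : Addable W P Q) :
    chordSlope W P Q * chordDen W P Q = chordNum W P Q := by
  rw [chordSlope, mul_assoc, Ring.inverse_mul_cancel _ h.den, mul_one]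

lemma snd_eq_left : P.2 = chordSlope W P Q * P.1 + chordIntercept W P Q := by
  rw [chordIntercept]; ring

/-- Subtracting the two curve equations gives (P.2 - Q.2) * den = (P.1 - Q.1) * num, and the
denominator cancels. -/
lemma snd_eq_right (hP : ZWEquation W P) (hQ : ZWEquation W Q) (h : Addable W P Q) :
    Q.2 = chordSlope W P Q * Q.1 + chordIntercept W P Q := by
  have key : (P.2 - Q.2) * chordDen W P Q = (chordSlope W P Q * (P.1 - Q.1)) * chordDen W P Q := by
    rw [mul_right_comm, chordSlope_mul_chordDen h]
    simp only [chordDen, chordNum]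
    rw [ZWEquation] at hP hQ
    linear_combination hP - hQ
  have := h.den.mul_right_cancel key
  rw [chordIntercept]
  linear_combination -this

lemma thirdPoint_snd :
    (thirdPoint W P Q).2 = chordSlope W P Q * (thirdPoint W P Q).1 + chordIntercept W P Q := rfl

/-- This and the next two lemmas are Vieta's relations for the cubic obtained by substituting w = l
z + n. They rest on the slope equation, not on distinct roots, so they cover tangents and rings with
zero divisors. -/
lemma cubicQuad_eq (h : Addable W P Q) :
    cubicQuad W (chordSlope W P Q) (chordIntercept W P Q) =
      -cubicLead W (chordSlope W P Q) * (P.1 + Q.1 + (thirdPoint W P Q).1) := by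
  simp only [thirdPoint]
  have := Ring.mul_inverse_cancel _ h.lead
  linear_combination
    (-cubicQuad W (chordSlope W P Q) (chordIntercept W P Q)) * this

lemma cubicLin_eq (hP : ZWEquation W P) (hQ : ZWEquation W Q) (h : Addable W P Q) :
    let l := chordSlope W P Q
    let n := chordIntercept W P Q
    l - W.a₁ * n - 2 * W.a₃ * l * n - W.a₄ * n ^ 2 - 3 * W.a₆ * l * n ^ 2 =
      -cubicLead W l * (P.1 * Q.1 + P.1 * (thirdPoint W P Q).1 + Q.1 * (thirdPoint W P Q).1) := by
  intro l n
  have h1 : P.2 = l * P.1 + n := snd_eq_left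
  have h2 : Q.2 = l * Q.1 + n := snd_eq_right hP hQ h
  have h3 : l * chordDen W P Q = chordNum W P Q := chordSlope_mul_chordDen h
  have h4 : cubicQuad W l n = -cubicLead W l * (P.1 + Q.1 + (thirdPoint W P Q).1) := cubicQuad_eq h
  simp only [chordDen, chordNum, h1, h2] at h3
  simp only [cubicQuad, cubicLead] at h4 ⊢
  linear_combination h3 + (P.1 + Q.1) * h4

lemma cubicConst_eq (hP : ZWEquation W P) (hQ : ZWEquation W Q) (h : Addable W P Q) :
    let l := chordSlope W P Q
    let n := chordIntercept W P Q
    n - W.a₃ * n ^ 2 - W.a₆ * n ^ 3 =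
      cubicLead W l * (P.1 * Q.1 * (thirdPoint W P Q).1) := by
  intro l n
  have h1 : P.2 = l * P.1 + n := snd_eq_left
  have h3 := cubicLin_eq hP hQ h
  have h4 : cubicQuad W l n = -cubicLead W l * (P.1 + Q.1 + (thirdPoint W P Q).1) := cubicQuad_eq h
  rw [ZWEquation, h1] at hP
  simp only [cubicQuad, cubicLead] at h3 h4 ⊢
  linear_combination hP + P.1 ^ 2 * h4 - P.1 * h3

lemma zwEquation_thirdPoint (hP : ZWEquation W P) (hQ : ZWEquation W Q) (h : Addable W P Q) :
    ZWEquation W (thirdPoint W P Q) := by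
  have h3 := cubicLin_eq hP hQ h
  have h4 := cubicQuad_eq h
  have h5 := cubicConst_eq hP hQ h
  rw [ZWEquation, thirdPoint_snd]
  simp only [cubicQuad, cubicLead] at h3 h4 h5 ⊢
  linear_combination (thirdPoint W P Q).1 * h3 - (thirdPoint W P Q).1 ^ 2 * h4 + h5

lemma zwEquation_negParams (hP : ZWEquation W P) (h : IsUnit (negDen W P)) :
    ZWEquation W (negParams W P) := by
  have h1 := Ring.mul_inverse_cancel _ h
  simp only [ZWEquation, negParams] at hP ⊢
  set i := Ring.inverse (negDen W P)
  rw [negDen] at h1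
  linear_combination (-i ^ 3) * hP + (P.2 * i + P.2 * i ^ 2) * h1

lemma zwEquation_addParams (hP : ZWEquation W P) (hQ : ZWEquation W Q) (h : Addable W P Q) :
    ZWEquation W (addParams W P Q) :=
  zwEquation_negParams (zwEquation_thirdPoint hP hQ h) h.neg

/-- If the chord through two points passes through the origin and the product of their
`z`-coordinates vanishes, then their sum is obtained by adding the coordinates. -/
lemma addParams_eq_of_intercept (hP : ZWEquation W P) (hQ : ZWEquation W Q) (h : Addable W P Q)
    (hn : chordIntercept W P Q = 0) (hPQ : P.1 * Q.1 = 0) :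
    addParams W P Q = P + Q := by
  have h2 := snd_eq_left (W := W) (P := P) (Q := Q)
  have h2' := snd_eq_right hP hQ h
  have h3 := cubicLin_eq hP hQ h
  have h4 := cubicQuad_eq h
  have h1 := Ring.mul_inverse_cancel _ h.neg
  simp only [hn, cubicQuad, negDen, thirdPoint_snd] at h1 h2 h2' h3 h4
  -- With S = P.1 + Q.1 and t the third root, Vieta for n = 0 and P.1 * Q.1 = 0 gives S + t = (a₁ +
  -- a₃ l) S t, that is -t = S * negDen.
  have key : (-(thirdPoint W P Q).1 - (P.1 + Q.1) * negDen W (thirdPoint W P Q)) = 0 := by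
    apply h.lead.mul_left_cancel
    simp only [negDen, thirdPoint_snd, hn]
    linear_combination -h4 + (W.a₁ + W.a₃ * chordSlope W P Q) *
      (h3 - cubicLead W (chordSlope W P Q) * hPQ)
  simp only [negDen, thirdPoint_snd, hn] at key
  simp only [addParams, negParams, negDen, thirdPoint_snd, hn]
  ext
  · simp only [Prod.fst_add]
    linear_combination
      (Ring.inverse (1 - W.a₁ * (thirdPoint W P Q).1 -
        W.a₃ * (chordSlope W P Q * (thirdPoint W P Q).1 + 0))) * key + (P.1 + Q.1) * h1
  · simp only [Prod.snd_add]
    rw [h2, h2']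
    linear_combination
      (chordSlope W P Q) * ((Ring.inverse (1 - W.a₁ * (thirdPoint W P Q).1 -
        W.a₃ * (chordSlope W P Q * (thirdPoint W P Q).1 + 0))) * key + (P.1 + Q.1) * h1)

end Chord

section Chord

variable {R : Type*} [CommRing R] {W : WeierstrassCurve R} {P Q : R × R}

lemma addParams_eq_add_of_mul_eq_zero (hP : ZWEquation W P) (hQ : ZWEquation W Q)
    (h : Addable W P Q) (h₁ : P.1 * Q.1 = 0) (h₂ : Q.2 = 0) :
    addParams W P Q = P + Q := by
  refine addParams_eq_of_intercept hP hQ h ?_ h₁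
  refine h.den.mul_right_cancel ?_
  rw [zero_mul, chordIntercept, sub_mul, mul_right_comm, chordSlope_mul_chordDen h]
  simp only [chordDen, chordNum, h₂]
  rw [ZWEquation] at hP
  linear_combination hP - (P.1 + Q.1) * h₁

end Chord

/-! ### Compatibility of the formulas with ring homomorphisms -/

section Map

variable {R S : Type*} [CommRing R] [CommRing S] (f : R →+* S) {W : WeierstrassCurve R}
  {P Q : R × R}

lemma map_inverse_of_isUnit {u : R} (h : IsUnit u) : f (Ring.inverse u) = Ring.inverse (f u) := by
  obtain ⟨u, rfl⟩ := h
  rw [Ring.inverse_unit, show f (u : R) = (Units.map (f : R →* S) u : Sˣ) from rfl,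
    Ring.inverse_unit]
  rfl

lemma ZWEquation.map (h : ZWEquation W P) : ZWEquation (W.map f) (P.map f f) := by
  have := congr_arg f h
  simpa [ZWEquation] using this

lemma ZWEquation.of_map {f : R →+* S} (hf : Function.Injective f)
    (h : ZWEquation (W.map f) (P.map f f)) : ZWEquation W P := by
  apply hf
  simpa [ZWEquation] using h

lemma map_chordSlope (h : IsUnit (chordDen W P Q)) :
    f (chordSlope W P Q) = chordSlope (W.map f) (P.map f f) (Q.map f f) := by
  rw [chordSlope, map_mul, map_inverse_of_isUnit f h]
  simp [chordSlope, chordNum, chordDen]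

lemma map_cubicLead (l : R) : f (cubicLead W l) = cubicLead (W.map f) (f l) := by
  simp [cubicLead]

lemma map_chordDen : f (chordDen W P Q) = chordDen (W.map f) (P.map f f) (Q.map f f) := by
  simp [chordDen]

lemma map_negDen : f (negDen W P) = negDen (W.map f) (P.map f f) := by
  simp [negDen]

lemma map_thirdPoint (h₁ : IsUnit (chordDen W P Q))
    (h₂ : IsUnit (cubicLead W (chordSlope W P Q))) :
    (thirdPoint W P Q).map f f = thirdPoint (W.map f) (P.map f f) (Q.map f f) := by
  simp [thirdPoint, cubicQuad, chordIntercept, map_chordSlope f h₁, map_inverse_of_isUnit f h₂,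
    map_cubicLead, map_ofNat]

lemma Addable.map (h : Addable W P Q) : Addable (W.map f) (P.map f f) (Q.map f f) where
  den := by rw [← map_chordDen]; exact h.den.map f
  lead := by rw [← map_chordSlope f h.den, ← map_cubicLead]; exact h.lead.map f
  neg := by rw [← map_thirdPoint f h.den h.lead, ← map_negDen]; exact h.neg.map f

lemma map_negParams (h : IsUnit (negDen W P)) :
    (negParams W P).map f f = negParams (W.map f) (P.map f f) := by
  simp [negParams, map_inverse_of_isUnit f h, map_negDen]

lemma map_addParams (h : Addable W P Q) :
    (addParams W P Q).map f f = addParams (W.map f) (P.map f f) (Q.map f f) := by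
  rw [addParams, map_negParams f h.neg, map_thirdPoint f h.den h.lead, addParams]

end Map

/-! ### Points with coordinates in an ideal -/

section Ideal

variable {R : Type*} [CommRing R] {W : WeierstrassCurve R} {P Q : R × R} {I : Ideal R}

/-- Both coordinates of the point lie in the ideal. -/
def ParamsMem (I : Ideal R) (P : R × R) : Prop := P.1 ∈ I ∧ P.2 ∈ I

lemma ParamsMem.zero : ParamsMem I 0 := ⟨I.zero_mem, I.zero_mem⟩

lemma ParamsMem.mono {J : Ideal R} (hIJ : I ≤ J) (h : ParamsMem I P) : ParamsMem J P :=
  ⟨hIJ h.1, hIJ h.2⟩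

/-- The numerator has no constant term; no invertibility of the denominator is needed. -/
lemma chordSlope_mem (hP : ParamsMem I P) (hQ : ParamsMem I Q) : chordSlope W P Q ∈ I := by
  refine I.mul_mem_right _ (Ideal.Quotient.eq_zero_iff_mem.mp ?_)
  simp [chordNum, Ideal.Quotient.eq_zero_iff_mem.mpr hP.1, Ideal.Quotient.eq_zero_iff_mem.mpr hQ.1,
    Ideal.Quotient.eq_zero_iff_mem.mpr hQ.2]

lemma paramsMem_thirdPoint (hP : ParamsMem I P) (hQ : ParamsMem I Q) :
    ParamsMem I (thirdPoint W P Q) := by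
  have h := Ideal.Quotient.eq_zero_iff_mem.mpr (chordSlope_mem (W := W) hP hQ)
  have h₁ := Ideal.Quotient.eq_zero_iff_mem.mpr hP.1
  have h₂ := Ideal.Quotient.eq_zero_iff_mem.mpr hP.2
  have h₃ := Ideal.Quotient.eq_zero_iff_mem.mpr hQ.1
  constructor <;> refine Ideal.Quotient.eq_zero_iff_mem.mp ?_ <;>
    simp [thirdPoint, cubicQuad, chordIntercept, h, h₁, h₂, h₃]

lemma paramsMem_negParams (hP : ParamsMem I P) : ParamsMem I (negParams W P) :=
  ⟨I.mul_mem_right _ (I.neg_mem hP.1), I.mul_mem_right _ (I.neg_mem hP.2)⟩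

lemma paramsMem_addParams (hP : ParamsMem I P) (hQ : ParamsMem I Q) :
    ParamsMem I (addParams W P Q) :=
  paramsMem_negParams (paramsMem_thirdPoint hP hQ)

lemma paramsMem_nsmulParams (hP : ParamsMem I P) (n : ℕ) : ParamsMem I (nsmulParams W P n) := by
  induction n with
  | zero => exact ParamsMem.zero
  | succ n ih => exact paramsMem_addParams ih hP

end Ideal

/-! ### Addition near the origin over a local ring -/

section Local

open IsLocalRing

variable {R : Type*} [CommRing R] [IsLocalRing R] {W : WeierstrassCurve R} {P Q : R × R}

lemma isUnit_of_one_sub_mem {u : R} (h : 1 - u ∈ maximalIdeal R) : IsUnit u := by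
  simpa using isUnit_one_sub_self_of_mem_nonunits _ h

lemma isUnit_chordDen (hP : ParamsMem (maximalIdeal R) P) (hQ : ParamsMem (maximalIdeal R) Q) :
    IsUnit (chordDen W P Q) := by
  refine isUnit_of_one_sub_mem (Ideal.Quotient.eq_zero_iff_mem.mp ?_)
  simp [chordDen, Ideal.Quotient.eq_zero_iff_mem.mpr hP.1, Ideal.Quotient.eq_zero_iff_mem.mpr hP.2,
    Ideal.Quotient.eq_zero_iff_mem.mpr hQ.2]

lemma isUnit_negDen (hP : ParamsMem (maximalIdeal R) P) : IsUnit (negDen W P) := by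
  refine isUnit_of_one_sub_mem (Ideal.Quotient.eq_zero_iff_mem.mp ?_)
  simp [negDen, Ideal.Quotient.eq_zero_iff_mem.mpr hP.1, Ideal.Quotient.eq_zero_iff_mem.mpr hP.2]

lemma addable_of_mem (hP : ParamsMem (maximalIdeal R) P) (hQ : ParamsMem (maximalIdeal R) Q) :
    Addable W P Q where
  den := isUnit_chordDen hP hQ
  lead := by
    refine isUnit_of_one_sub_mem (Ideal.Quotient.eq_zero_iff_mem.mp ?_)
    simp [cubicLead, Ideal.Quotient.eq_zero_iff_mem.mpr (chordSlope_mem (W := W) hP hQ)]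
  neg := isUnit_negDen (paramsMem_thirdPoint hP hQ)

lemma zwEquation_nsmulParams (hP : ParamsMem (maximalIdeal R) P) (h : ZWEquation W P) (n : ℕ) :
    ZWEquation W (nsmulParams W P n) := by
  induction n with
  | zero => simp [nsmulParams, ZWEquation]
  | succ n ih =>
    exact zwEquation_addParams ih h (addable_of_mem (paramsMem_nsmulParams hP n) hP)

lemma map_nsmulParams {S : Type*} [CommRing S] (f : R →+* S) (hP : ParamsMem (maximalIdeal R) P)
    (n : ℕ) : (nsmulParams W P n).map f f = nsmulParams (W.map f) (P.map f f) n := by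
  induction n with
  | zero => simp [nsmulParams, Prod.map]
  | succ n ih =>
    rw [nsmulParams, map_addParams f (addable_of_mem (paramsMem_nsmulParams hP n) hP), ih,
      nsmulParams]

/-- On the curve near the origin, `w` is determined by `z`. -/
lemma snd_eq_of_fst_eq (hP : ParamsMem (maximalIdeal R) P) (hQ : ParamsMem (maximalIdeal R) Q)
    (eP : ZWEquation W P) (eQ : ZWEquation W Q) (h : P.1 = Q.1) : P.2 = Q.2 := by
  refine sub_eq_zero.mp ((isUnit_chordDen (W := W) hP hQ).mul_left_eq_zero.mp ?_)
  rw [ZWEquation] at eP eQ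
  simp only [chordDen]
  rw [← h] at eQ
  linear_combination eP - eQ

/-- The curve equation reads w * chordDen(P, 0) = z ^ 3, with a unit as the factor of w. -/
lemma fst_pow_three_dvd_snd (hP : ParamsMem (maximalIdeal R) P) (eP : ZWEquation W P) :
    P.1 ^ 3 ∣ P.2 := by
  rw [← (isUnit_chordDen (W := W) hP ParamsMem.zero).dvd_mul_right]
  refine dvd_of_eq ?_
  rw [ZWEquation] at eP
  simp only [chordDen, Prod.snd_zero]
  linear_combination -eP

/-- First-order additivity: modulo `J` both P.1 * Q.1 and Q.2 (a multiple of Q.1 ^ 3) vanish, so the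
sum is coordinatewise there. With I = (X) it yields the linear term of [n]; with the maximal ideal
it compares z(P - Q) to z(P) - z(Q). -/
lemma addParams_fst_sub_mem {I : Ideal R} (hI : I ≤ maximalIdeal R) (hP : ParamsMem I P)
    (hQ : ParamsMem I Q) (eP : ZWEquation W P) (eQ : ZWEquation W Q) :
    (addParams W P Q).1 - (P.1 + Q.1) ∈ Ideal.span {Q.1} * I := by
  set J := Ideal.span {Q.1} * I
  have hadd : Addable W P Q := addable_of_mem (hP.mono hI) (hQ.mono hI)
  have h₁ : P.1 * Q.1 ∈ J := by
    rw [mul_comm]; exact Ideal.mul_mem_mul (Ideal.mem_span_singleton_self _) hP.1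
  have h₂ : Q.1 ^ 2 ∈ J := by
    rw [sq]; exact Ideal.mul_mem_mul (Ideal.mem_span_singleton_self _) hQ.1
  have h₃ : Q.2 ∈ J := by
    refine Ideal.mem_of_dvd _ ?_ h₂
    exact (pow_dvd_pow _ (by norm_num)).trans (fst_pow_three_dvd_snd (hQ.mono hI) eQ)
  rw [← Ideal.Quotient.eq_zero_iff_mem] at h₁ h₃
  rw [← Ideal.Quotient.eq]
  have := addParams_eq_add_of_mul_eq_zero (eP.map (Ideal.Quotient.mk J))
    (eQ.map (Ideal.Quotient.mk J)) (hadd.map _) (by simpa using h₁) h₃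
  rw [← map_addParams _ hadd] at this
  simpa using congr_arg Prod.fst this

end Local

/-! ### Comparison with the group law over a field -/

section Field

open WeierstrassCurve

variable {M : Type*} [Field M] {V : WeierstrassCurve M}

/-- The point has coordinates `z = -x/y` and `w = -1/y`, which are `0` at the point at infinity. -/
def HasParams : V.toAffine.Point → M × M → Prop
  | .zero, a => a = 0
  | .some x y _, a => x * a.2 = a.1 ∧ y * a.2 = -1

lemma hasParams_zero : HasParams (0 : V.toAffine.Point) 0 := rfl

lemma HasParams.eq {P : V.toAffine.Point} {a b : M × M} (ha : HasParams P a)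
    (hb : HasParams P b) : a = b := by
  rcases P with _ | ⟨x, y, h⟩
  · exact Eq.trans ha (Eq.symm hb)
  · have hy : y ≠ 0 := by
      rintro rfl
      have := ha.2
      simp at this
    have h2 : a.2 = b.2 := mul_left_cancel₀ hy (ha.2.trans hb.2.symm)
    exact Prod.ext (by rw [← ha.1, ← hb.1, h2]) h2

lemma HasParams.z_eq {P : V.toAffine.Point} {a : M × M} (ha : HasParams P a) : z P = a.1 := by
  rcases P with _ | ⟨x, y, h⟩
  · have : a = 0 := ha
    simp [z, this]
  · have hy : y ≠ 0 := by
      rintro rfl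
      have := ha.2
      simp at this
    rw [z, ← ha.1, div_eq_iff hy]
    linear_combination -x * ha.2

lemma HasParams.zwEquation {P : V.toAffine.Point} {a : M × M} (ha : HasParams P a) :
    ZWEquation V a := by
  rcases P with _ | ⟨x, y, h⟩
  · have : a = 0 := ha
    simp [ZWEquation, this]
  · have e := (Affine.equation_iff ..).mp h.1
    obtain ⟨h1, h2⟩ := ha
    rw [ZWEquation, ← h1]
    linear_combination a.2 ^ 3 * e + (a.2 - a.2 * (y * a.2) - V.a₁ * x * a.2 ^ 2 -
      V.a₃ * a.2 ^ 2) * h2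

lemma HasParams.neg {P : V.toAffine.Point} {a : M × M} (ha : HasParams P a)
    (hn : IsUnit (negDen V a)) : HasParams (-P) (negParams V a) := by
  rcases P with _ | ⟨x, y, h⟩
  · have : a = 0 := ha
    subst this
    show negParams V 0 = 0
    simp [negParams]
  · obtain ⟨h1, h2⟩ := ha
    have h3 := Ring.mul_inverse_cancel _ hn
    simp only [HasParams, negParams, Affine.Point.neg_some, Affine.negY]
    set i := Ring.inverse (negDen V a)
    rw [negDen] at h3
    constructor
    · linear_combination (-i) * h1
    · linear_combination i * h2 + V.a₁ * i * h1 - h3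

variable [DecidableEq M]

/-- For n ≠ 0 the line w = l z + n is the affine line n y = l x - 1, which is not vertical and has
slope l / n. -/
lemma hasParams_neg_add_of_intercept_ne_zero {x₁ y₁ x₂ y₂ : M}
    {h₁ : V.toAffine.Nonsingular x₁ y₁} {h₂ : V.toAffine.Nonsingular x₂ y₂} {a b : M × M}
    (ha : HasParams (.some x₁ y₁ h₁) a) (hb : HasParams (.some x₂ y₂ h₂) b)
    (h : Addable V a b) (hn : chordIntercept V a b ≠ 0) :
    HasParams (-(.some x₁ y₁ h₁ + .some x₂ y₂ h₂)) (thirdPoint V a b) := by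
  have ea := ha.zwEquation
  have eb := hb.zwEquation
  have hw₁ : a.2 ≠ 0 := by
    intro h0
    have := ha.2
    simp [h0] at this
  have hw₂ : b.2 ≠ 0 := by
    intro h0
    have := hb.2
    simp [h0] at this
  have l₁ : a.2 = chordSlope V a b * a.1 + chordIntercept V a b := snd_eq_left
  have l₂ := snd_eq_right ea eb h
  have l₃ := thirdPoint_snd (W := V) (P := a) (Q := b)
  have hslope := chordSlope_mul_chordDen h
  have v₁ := cubicQuad_eq h
  have v₂ := cubicLin_eq ea eb h
  have v₃ := cubicConst_eq ea eb h
  have hc := h.lead.ne_zero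
  have hd := h.den.ne_zero
  obtain ⟨ha₁, ha₂⟩ := ha
  obtain ⟨hb₁, hb₂⟩ := hb
  set l := chordSlope V a b
  set n := chordIntercept V a b
  set c := thirdPoint V a b
  have line₁ : n * y₁ = l * x₁ - 1 := by
    apply mul_right_cancel₀ hw₁
    linear_combination n * ha₂ - l * ha₁ + l₁
  have line₂ : n * y₂ = l * x₂ - 1 := by
    apply mul_right_cancel₀ hw₂
    linear_combination n * hb₂ - l * hb₁ + l₂
  have tangent : x₁ = x₂ → y₁ ≠ V.toAffine.negY x₂ y₂ ∧
      V.toAffine.slope x₁ x₂ y₁ y₂ = l / n := by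
    rintro rfl
    have hy : y₁ = y₂ := mul_left_cancel₀ hn (line₁.trans line₂.symm)
    subst hy
    have hab : a.2 = b.2 := by
      apply mul_left_cancel₀ (left_ne_zero_of_mul (a := y₁) (b := a.2) (by simp [ha₂]))
      rw [ha₂, hb₂]
    have hab' : a.1 = b.1 := by rw [← ha₁, ← hb₁, hab]
    -- This identity turns n ≠ 0 and an invertible denominator into a non-vertical tangent.
    have hF : n * chordDen V a b = a.2 ^ 2 * (y₁ - V.toAffine.negY x₁ y₁) := by
      have : n = a.2 - l * a.1 := rfl
      rw [this, sub_mul, mul_right_comm, hslope]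
      rw [ZWEquation] at ea
      simp only [chordDen, chordNum, Affine.negY, ← hab, ← hab']
      linear_combination 3 * ea - 2 * a.2 * ha₂ - V.a₁ * a.2 * ha₁
    have hy : y₁ ≠ V.toAffine.negY x₁ y₁ := by
      intro h0
      rw [← h0, sub_self, mul_zero] at hF
      exact mul_ne_zero hn hd hF
    refine ⟨hy, ?_⟩
    rw [Affine.slope_of_Y_ne rfl hy, div_eq_div_iff (sub_ne_zero.mpr hy) hn]
    apply mul_left_cancel₀ (mul_ne_zero hd (pow_ne_zero 2 hw₁))
    have hX : a.2 ^ 2 * (3 * x₁ ^ 2 + 2 * V.a₂ * x₁ + V.a₄ - V.a₁ * y₁) = chordNum V a b := by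
      simp only [chordNum, ← hab, ← hab', ← ha₁]
      linear_combination (-V.a₁ * a.2) * ha₂
    linear_combination n * chordDen V a b * hX + chordNum V a b * hF -
      a.2 ^ 2 * (y₁ - V.toAffine.negY x₁ y₁) * hslope
  have hxy : ¬(x₁ = x₂ ∧ y₁ = V.toAffine.negY x₂ y₂) := fun hh ↦ (tangent hh.1).1 hh.2
  have hl : V.toAffine.slope x₁ x₂ y₁ y₂ = l / n := by
    by_cases hx : x₁ = x₂
    · exact (tangent hx).2
    · rw [Affine.slope_of_X_ne hx, div_eq_div_iff (sub_ne_zero.mpr hx) hn]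
      linear_combination line₁ - line₂
  -- Since x = z / w, the quotient of `key` below by `hw₃` is the sum of the three x-coordinates, (l
  -- / n)² + a₁ (l / n) - a₂, as `addX` requires.
  have hw₃ : cubicLead V l * (a.2 * b.2 * c.2) = n ^ 3 := by
    rw [l₁, l₂, l₃]
    simp only [cubicQuad, cubicLead] at v₁ v₂ v₃ ⊢
    linear_combination (-l ^ 3) * v₃ + l ^ 2 * n * v₂ + l * n ^ 2 * v₁
  have hX : (V.toAffine.addX x₁ x₂ (l / n)) * c.2 = c.1 := by
    have hx₁ : x₁ = a.1 / a.2 := by rw [eq_div_iff hw₁, ha₁]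
    have hx₂ : x₂ = b.1 / b.2 := by rw [eq_div_iff hw₂, hb₁]
    have key : cubicLead V l * (a.1 * b.2 * c.2 + b.1 * a.2 * c.2 + c.1 * a.2 * b.2) =
        n * (l ^ 2 + V.a₁ * l * n - V.a₂ * n ^ 2) := by
      rw [l₁, l₂, l₃]
      simp only [cubicQuad, cubicLead] at v₁ v₂ v₃ ⊢
      linear_combination (-3 * l ^ 2) * v₃ + 2 * l * n * v₂ + n ^ 2 * v₁
    rw [Affine.addX, hx₁, hx₂]
    field_simp
    apply mul_left_cancel₀ (mul_ne_zero hc hn)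
    linear_combination (l ^ 2 + V.a₁ * l * n - V.a₂ * n ^ 2) * n * hw₃ - n ^ 3 * key
  rw [Affine.Point.add_some hxy, Affine.Point.neg_some]
  simp only [HasParams, Affine.addY, Affine.negY_negY, Affine.negAddY, hl]
  refine ⟨hX, ?_⟩
  apply mul_left_cancel₀ hn
  have : n * (l / n) = l := mul_div_cancel₀ _ hn
  linear_combination l * hX + (V.toAffine.addX x₁ x₂ (l / n) * c.2 - x₁ * c.2) * this +
    c.2 * line₁ - l₃

/-- The formula for the sum of two points describes the group law of the curve. -/
lemma HasParams.add {P Q : V.toAffine.Point} {a b : M × M} (ha : HasParams P a)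
    (hb : HasParams Q b) (h : Addable V a b) : HasParams (P + Q) (addParams V a b) := by
  have ea := ha.zwEquation
  have eb := hb.zwEquation
  rcases P with _ | ⟨x₁, y₁, h₁⟩
  · have h0 : a = 0 := ha
    subst h0
    rw [addParams_eq_of_intercept ea eb h (by simp [chordIntercept]) (by simp)]
    rw [← Affine.Point.zero_def, zero_add, zero_add]
    exact hb
  rcases Q with _ | ⟨x₂, y₂, h₂⟩
  · have h0 : b = 0 := hb
    subst h0
    have hn := snd_eq_right ea eb h
    rw [addParams_eq_of_intercept ea eb h (by simpa using hn.symm) (by simp)]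
    rw [← Affine.Point.zero_def, add_zero, add_zero]
    exact ha
  -- A zero intercept means that the line passes through the point at infinity: the third point is
  -- the origin, both points have x = 1 / l, and they are inverse to each other.
  by_cases hn : chordIntercept V a b = 0
  · have hw₁ : a.2 ≠ 0 := by
      intro h0
      have := ha.2
      simp [h0] at this
    have hw₂ : b.2 ≠ 0 := by
      intro h0
      have := hb.2
      simp [h0] at this
    have l₁ := snd_eq_left (W := V) (P := a) (Q := b)
    have l₂ := snd_eq_right ea eb h
    have l₃ := thirdPoint_snd (W := V) (P := a) (Q := b)
    have v₁ := cubicQuad_eq h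
    have v₂ := cubicLin_eq ea eb h
    have v₃ := cubicConst_eq ea eb h
    have hc := h.lead.ne_zero
    obtain ⟨ha₁, ha₂⟩ := ha
    obtain ⟨hb₁, hb₂⟩ := hb
    rw [hn, add_zero] at l₁ l₂ l₃
    have hl : chordSlope V a b ≠ 0 := by
      intro h0
      rw [h0, zero_mul] at l₁
      exact hw₁ l₁
    have hz₁ : a.1 ≠ 0 := right_ne_zero_of_mul (l₁ ▸ hw₁)
    have hz₂ : b.1 ≠ 0 := right_ne_zero_of_mul (l₂ ▸ hw₂)
    have hz₃ : (thirdPoint V a b).1 = 0 := by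
      simp only [hn] at v₃
      have : cubicLead V (chordSlope V a b) * (a.1 * b.1) * (thirdPoint V a b).1 = 0 := by
        linear_combination -v₃
      exact (mul_eq_zero.mp this).resolve_left (mul_ne_zero hc (mul_ne_zero hz₁ hz₂))
    have h0 : thirdPoint V a b = 0 := Prod.ext hz₃ (by rw [l₃, hz₃, mul_zero]; rfl)
    have hsum : addParams V a b = 0 := by
      rw [addParams, h0]
      simp [negParams]
    rw [hsum]
    have hx₁ : chordSlope V a b * x₁ = 1 := by
      apply mul_right_cancel₀ hz₁
      linear_combination ha₁ - x₁ * l₁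
    have hx₂ : chordSlope V a b * x₂ = 1 := by
      apply mul_right_cancel₀ hz₂
      linear_combination hb₁ - x₂ * l₂
    have hx : x₁ = x₂ := mul_left_cancel₀ hl (hx₁.trans hx₂.symm)
    have hy : y₁ = V.toAffine.negY x₂ y₂ := by
      simp only [hn, hz₃, cubicQuad] at v₁ v₂
      rw [l₁] at ha₂
      rw [l₂] at hb₂
      apply mul_left_cancel₀ (mul_ne_zero hc (mul_ne_zero hl (mul_ne_zero hz₁ hz₂)))
      rw [Affine.negY]
      linear_combination
        cubicLead V (chordSlope V a b) * b.1 * ha₂ + cubicLead V (chordSlope V a b) * a.1 * hb₂ +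
        V.a₁ * cubicLead V (chordSlope V a b) * a.1 * b.1 * hx₂ - v₁ +
        (V.a₁ + V.a₃ * chordSlope V a b) * v₂
    rw [Affine.Point.add_of_Y_eq hx hy]
    exact hasParams_zero
  · rw [← neg_neg (Affine.Point.some x₁ y₁ h₁ + Affine.Point.some x₂ y₂ h₂)]
    exact (hasParams_neg_add_of_intercept_ne_zero ha hb h hn).neg h.neg

end Field

/-! ### Power series at nilpotent elements -/

section Truncation

open PowerSeries

variable {A S : Type*} [CommRing A] [CommRing S] [Algebra A S]

lemma aeval_trunc_coe {s : S} {N : ℕ} (hs : s ^ N = 0) (f : Polynomial A) :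
    Polynomial.aeval s (trunc N (f : A⟦X⟧)) = Polynomial.aeval s f := by
  rw [eq_comm, ← sub_eq_zero, ← map_sub]
  have : Polynomial.X ^ N ∣ f - trunc N (f : A⟦X⟧) := by
    rw [Polynomial.X_pow_dvd_iff]
    intro d hd
    simp [coeff_trunc, hd]
  obtain ⟨g, hg⟩ := this
  rw [hg]
  simp [hs]

/-- Evaluation of power series at an element whose `N`-th power vanishes. -/
def evalNilpotent {s : S} {N : ℕ} (hs : s ^ N = 0) (hN : N ≠ 0) : A⟦X⟧ →+* S where
  toFun f := Polynomial.aeval s (trunc N f)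
  map_one' := by
    obtain ⟨N, rfl⟩ := Nat.exists_eq_succ_of_ne_zero hN
    simp
  map_zero' := by simp
  map_add' f g := by simp
  map_mul' f g := by
    rw [← trunc_trunc_mul_trunc, ← map_mul, ← Polynomial.coe_mul, aeval_trunc_coe hs]

lemma evalNilpotent_apply {s : S} {N : ℕ} (hs : s ^ N = 0) (hN : N ≠ 0) (f : A⟦X⟧) :
    evalNilpotent hs hN f = Polynomial.aeval s (trunc N f) := rfl

lemma evalNilpotent_comp_algebraMap {s : S} {N : ℕ} (hs : s ^ N = 0) (hN : N ≠ 0) :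
    (evalNilpotent hs hN).comp (algebraMap A A⟦X⟧) = algebraMap A S := by
  obtain ⟨N, rfl⟩ := Nat.exists_eq_succ_of_ne_zero hN
  ext a
  simp [evalNilpotent_apply]

end Truncation

/-! ### The expansion of w in z and the multiplication series -/

section WSeries

open PowerSeries

variable {A : Type*} [CommRing A]

instance isLocalRing_powerSeries [IsLocalRing A] : IsLocalRing A⟦X⟧ :=
  inferInstanceAs (IsLocalRing (MvPowerSeries Unit A))

lemma span_X_le_maximalIdeal [IsLocalRing A] :
    Ideal.span {(X : A⟦X⟧)} ≤ IsLocalRing.maximalIdeal A⟦X⟧ := by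
  rw [Ideal.span_singleton_le_iff_mem, IsLocalRing.mem_maximalIdeal]
  intro h
  have := h.map (constantCoeff (R := A))
  simp at this

variable (W : WeierstrassCurve A)

/-- The successive approximations to the expansion of `w` as a power series in `z`. -/
def wApprox : ℕ → A⟦X⟧
  | 0 => 0
  | n + 1 => X ^ 3 + C W.a₁ * X * wApprox n + C W.a₂ * X ^ 2 * wApprox n + C W.a₃ * wApprox n ^ 2 +
      C W.a₄ * X * wApprox n ^ 2 + C W.a₆ * wApprox n ^ 3

/-- The expansion of `w` as a power series in `z`. -/
def wSeries : A⟦X⟧ := PowerSeries.mk fun n ↦ coeff n (wApprox W (n + 1))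

lemma X_dvd_wApprox (n : ℕ) : X ∣ wApprox W n := by
  induction n with
  | zero => exact dvd_zero _
  | succ n ih =>
    obtain ⟨v, hv⟩ := ih
    refine ⟨X ^ 2 + C W.a₁ * wApprox W n + C W.a₂ * X * wApprox W n + C W.a₃ * v * wApprox W n +
      C W.a₄ * wApprox W n ^ 2 + C W.a₆ * v * wApprox W n ^ 2, ?_⟩
    simp only [wApprox, hv]
    ring

/-- The recursion is an X-adic contraction: each term involving w carries a factor X or is at least
quadratic in w. -/
lemma pow_succ_dvd_equation_sub {u v : A⟦X⟧} (hu : X ∣ u) (hv : X ∣ v) {n : ℕ}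
    (h : X ^ n ∣ u - v) : X ^ (n + 1) ∣
      (X ^ 3 + C W.a₁ * X * u + C W.a₂ * X ^ 2 * u + C W.a₃ * u ^ 2 +
        C W.a₄ * X * u ^ 2 + C W.a₆ * u ^ 3) -
      (X ^ 3 + C W.a₁ * X * v + C W.a₂ * X ^ 2 * v + C W.a₃ * v ^ 2 +
        C W.a₄ * X * v ^ 2 + C W.a₆ * v ^ 3) := by
  obtain ⟨s, hs⟩ := hu
  obtain ⟨t, ht⟩ := hv
  rw [pow_succ]
  have : (X ^ 3 + C W.a₁ * X * u + C W.a₂ * X ^ 2 * u + C W.a₃ * u ^ 2 +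
        C W.a₄ * X * u ^ 2 + C W.a₆ * u ^ 3) -
      (X ^ 3 + C W.a₁ * X * v + C W.a₂ * X ^ 2 * v + C W.a₃ * v ^ 2 +
        C W.a₄ * X * v ^ 2 + C W.a₆ * v ^ 3) =
      (u - v) * (X * (C W.a₁ + C W.a₂ * X + C W.a₃ * (s + t) + C W.a₄ * (u + v) +
        C W.a₆ * X * (s ^ 2 + s * t + t ^ 2))) := by
    rw [hs, ht]; ring
  rw [this]
  exact mul_dvd_mul h (dvd_mul_right _ _)

lemma X_pow_dvd_wApprox_sub (n : ℕ) : X ^ n ∣ wApprox W (n + 1) - wApprox W n := by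
  induction n with
  | zero => simp
  | succ n ih =>
    exact pow_succ_dvd_equation_sub W (X_dvd_wApprox W _) (X_dvd_wApprox W _) ih

lemma X_pow_dvd_wApprox_sub_of_le {n m : ℕ} (h : n ≤ m) :
    X ^ n ∣ wApprox W m - wApprox W n := by
  induction m, h using Nat.le_induction with
  | base => simp
  | succ m hm ih =>
    have := dvd_add ((pow_dvd_pow X hm).trans (X_pow_dvd_wApprox_sub W m)) ih
    simpa using this

/-- Coefficient m is read off from `wApprox W (m + 1)`, and all later approximations agree with it
through degree m. -/
lemma X_pow_dvd_wSeries_sub (n : ℕ) : X ^ n ∣ wSeries W - wApprox W n := by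
  rw [X_pow_dvd_iff]
  intro m hm
  have := X_pow_dvd_iff.mp (X_pow_dvd_wApprox_sub_of_le W (show m + 1 ≤ n from hm)) m (by omega)
  rw [map_sub] at this ⊢
  rw [wSeries, coeff_mk, ← neg_sub, this, neg_zero]

lemma X_dvd_wSeries : X ∣ wSeries W := by
  have := dvd_add (X_pow_dvd_wSeries_sub W 1) (by simpa using X_dvd_wApprox W 1)
  simpa using this

/-- The generic point of the curve near the origin. -/
def genericParams : A⟦X⟧ × A⟦X⟧ := (X, wSeries W)

lemma zwEquation_genericParams : ZWEquation (W.map (algebraMap A A⟦X⟧)) (genericParams W) := by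
  simp only [ZWEquation, genericParams, WeierstrassCurve.map_a₁, WeierstrassCurve.map_a₂,
    WeierstrassCurve.map_a₃, WeierstrassCurve.map_a₄, WeierstrassCurve.map_a₆,
    PowerSeries.algebraMap_apply, Algebra.algebraMap_self, RingHom.id_apply]
  rw [← sub_eq_zero]
  ext n
  have h₁ := X_pow_dvd_wSeries_sub W (n + 2)
  have h₂ := (pow_dvd_pow X (by omega : n + 1 ≤ n + 2)).trans <|
    pow_succ_dvd_equation_sub W (X_dvd_wSeries W) (X_dvd_wApprox W (n + 1))
      (X_pow_dvd_wSeries_sub W (n + 1))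
  have := dvd_sub ((pow_dvd_pow X (by omega : n + 1 ≤ n + 2)).trans h₁) h₂
  have := X_pow_dvd_iff.mp this n (by omega)
  rw [map_zero, ← this, wApprox]
  congr 1
  ring

lemma paramsMem_genericParams : ParamsMem (Ideal.span {(X : A⟦X⟧)}) (genericParams W) :=
  ⟨Ideal.mem_span_singleton_self _, Ideal.mem_span_singleton.mpr (X_dvd_wSeries W)⟩

/-- The power series that expresses the parameter of the `n`-th multiple of a point by that of
the point. -/
def multSeries (n : ℕ) : A⟦X⟧ :=
  (nsmulParams (W.map (algebraMap A A⟦X⟧)) (genericParams W) n).1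

lemma X_dvd_multSeries (n : ℕ) : X ∣ multSeries W n :=
  Ideal.mem_span_singleton.mp (paramsMem_nsmulParams (paramsMem_genericParams W) n).1

variable [IsLocalRing A]

/-- By first-order additivity, adding the generic point adds X modulo X ^ 2. -/
lemma coeff_one_multSeries (n : ℕ) : coeff 1 (multSeries W n) = n := by
  induction n with
  | zero => simp [multSeries, nsmulParams]
  | succ n ih =>
    have hg := paramsMem_genericParams W
    have := addParams_fst_sub_mem (W := W.map (algebraMap A A⟦X⟧)) span_X_le_maximalIdeal
      (paramsMem_nsmulParams hg n) hg
      (zwEquation_nsmulParams (hg.mono span_X_le_maximalIdeal) (zwEquation_genericParams W) n)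
      (zwEquation_genericParams W)
    rw [show (genericParams W).1 = X from rfl, Ideal.span_singleton_mul_span_singleton,
      Ideal.mem_span_singleton, ← sq, X_pow_dvd_iff] at this
    have := this 1 (by norm_num)
    rw [map_sub, map_add, coeff_one_X, sub_eq_zero] at this
    rw [multSeries, nsmulParams, this, Nat.cast_succ, ← ih, multSeries]

/-- The parameter of the `n`-th multiple of a point is the value of `multSeries` at the parameter
of the point, up to any given order. -/
lemma nsmulParams_fst_sub_mem {R : Type*} [CommRing R] [IsLocalRing R] [Algebra A R] {P : R × R}
    (hP : ParamsMem (IsLocalRing.maximalIdeal R) P) (eP : ZWEquation (W.map (algebraMap A R)) P)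
    (n : ℕ) {N : ℕ} (hN : 2 ≤ N) :
    (nsmulParams (W.map (algebraMap A R)) P n).1 -
      Polynomial.aeval P.1 (trunc N (multSeries W n)) ∈ Ideal.span {P.1 ^ N} := by
  have hN0 : N ≠ 0 := by omega
  set J := Ideal.span {P.1 ^ N}
  let f := Ideal.Quotient.mk J
  have hJ : J ≠ ⊤ := by
    intro h
    have h1 : J ≤ IsLocalRing.maximalIdeal R := by
      rw [Ideal.span_singleton_le_iff_mem]
      exact Ideal.pow_mem_of_mem _ hP.1 _ (by omega)
    rw [h, top_le_iff] at h1
    exact (IsLocalRing.maximalIdeal.isMaximal R).ne_top h1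
  have : Nontrivial (R ⧸ J) := Ideal.Quotient.nontrivial_iff.mpr hJ
  have : IsLocalRing (R ⧸ J) := IsLocalRing.of_surjective' f Ideal.Quotient.mk_surjective
  have hz : (f P.1) ^ N = 0 := by
    rw [← map_pow]
    exact Ideal.Quotient.eq_zero_iff_mem.mpr (Ideal.mem_span_singleton_self _)
  have hzm : f P.1 ∈ IsLocalRing.maximalIdeal (R ⧸ J) :=
    (IsLocalRing.maximalIdeal.isMaximal (R ⧸ J)).isPrime.mem_of_pow_mem N
      (by rw [hz]; exact zero_mem _)
  -- `g` on the generic point and `f` on `P` agree in R / J: the z-coordinates since `2 ≤ N` keeps X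
  -- from being truncated, the w-coordinates since z determines w. Ring maps respect `nsmulParams`,
  -- so the multiples agree too.
  let g := evalNilpotent (A := A) hz hN0
  have hgX : g X = f P.1 := by
    simp [g, evalNilpotent_apply, trunc_X_of hN]
  have hcurve : (W.map (algebraMap A A⟦X⟧)).map g = (W.map (algebraMap A R)).map f := by
    rw [WeierstrassCurve.map_map, WeierstrassCurve.map_map, evalNilpotent_comp_algebraMap]
    rfl
  have hg : (genericParams W).map g g = P.map f f := by
    refine Prod.ext hgX ?_
    refine snd_eq_of_fst_eq (W := (W.map (algebraMap A R)).map f) ⟨?_, ?_⟩ ⟨hzm, ?_⟩ ?_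
      (eP.map f) hgX
    · rw [Prod.map_fst]; exact hgX ▸ hzm
    · obtain ⟨v, hv⟩ := X_dvd_wSeries W
      simp only [Prod.map_snd, genericParams]
      rw [hv, map_mul, hgX]
      exact Ideal.mul_mem_right _ _ hzm
    · obtain ⟨v, hv⟩ := fst_pow_three_dvd_snd hP eP
      rw [Prod.map_snd, hv, map_mul, map_pow]
      exact Ideal.mul_mem_right _ _ (Ideal.pow_mem_of_mem _ hzm _ (by norm_num))
    · rw [← hcurve]
      exact (zwEquation_genericParams W).map g
  have h₁ := map_nsmulParams (W := W.map (algebraMap A R)) f hP n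
  have h₂ := map_nsmulParams (W := W.map (algebraMap A A⟦X⟧)) g
    ((paramsMem_genericParams W).mono span_X_le_maximalIdeal) n
  rw [hcurve, hg, ← h₁] at h₂
  rw [← Ideal.Quotient.eq]
  refine (congr_arg Prod.fst h₂).symm.trans ?_
  show Polynomial.aeval (f P.1) (trunc N (multSeries W n)) = _
  exact Polynomial.aeval_algHom_apply (Ideal.Quotient.mkₐ A J) P.1 _

end WSeries

/-! ### Points with given parameters and their multiples -/

section Field

open WeierstrassCurve

lemma exists_hasParams {M : Type*} [Field M] {V : WeierstrassCurve M} [V.IsElliptic] {a : M × M}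
    (ha : ZWEquation V a) (h : a.2 ≠ 0) : ∃ P : V.toAffine.Point, HasParams P a := by
  have e : V.toAffine.Equation (a.1 / a.2) (-1 / a.2) := by
    rw [ZWEquation] at ha
    rw [Affine.equation_iff]
    field_simp
    linear_combination ha
  exact ⟨Affine.Point.mk e, div_mul_cancel₀ _ h, div_mul_cancel₀ _ h⟩

lemma HasParams.nsmul {R M : Type*} [CommRing R] [IsLocalRing R] [Field M] [DecidableEq M]
    {W : WeierstrassCurve R} {f : R →+* M} {P : (W.map f).toAffine.Point} {a : R × R}
    (ha : ParamsMem (IsLocalRing.maximalIdeal R) a) (h : HasParams P (a.map f f)) (n : ℕ) :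
    HasParams (n • P) ((nsmulParams W a n).map f f) := by
  induction n with
  | zero =>
    rw [zero_nsmul, nsmulParams]
    exact Prod.ext (map_zero f) (map_zero f)
  | succ n ih =>
    have hadd := addable_of_mem (W := W) (paramsMem_nsmulParams (W := W) ha n) ha
    rw [succ_nsmul, nsmulParams, map_addParams f hadd]
    exact ih.add h (hadd.map f)

end Field

/-! ### Lowest coefficients of compositions -/

section Coeff

open PowerSeries

variable {B : Type*} [CommRing B] {F G : B⟦X⟧}

lemma constantCoeff_aeval (hG : X ∣ G) (q : Polynomial B) :
    constantCoeff (Polynomial.aeval G q) = q.coeff 0 := by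
  obtain ⟨r, hr⟩ := Polynomial.X_dvd_sub_C (p := q)
  obtain ⟨G', rfl⟩ := hG
  rw [sub_eq_iff_eq_add] at hr
  conv_lhs => rw [hr]
  simp

/-- If F starts with c X^h and G with g X, then F ∘ G has g^h c in degree h. In the next lemma G ∘ F
has g c there, as F² starts beyond degree h. -/
lemma coeff_aeval_trunc_of_X_pow_dvd (hG : X ∣ G) {h N : ℕ} (hF : X ^ h ∣ F) (hN : h < N) :
    coeff h (Polynomial.aeval G (trunc N F)) = coeff 1 G ^ h * coeff h F := by
  have : Polynomial.X ^ h ∣ trunc N F := by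
    rw [Polynomial.X_pow_dvd_iff]
    intro d hd
    rw [coeff_trunc, if_pos (hd.trans hN), X_pow_dvd_iff.mp hF d hd]
  obtain ⟨q, hq⟩ := this
  have hq0 : q.coeff 0 = coeff h F := by
    have := congr_arg (Polynomial.coeff · h) hq
    simp only [coeff_trunc, if_pos hN, Polynomial.coeff_X_pow_mul', le_refl, if_true,
      Nat.sub_self] at this
    exact this.symm
  have hc := constantCoeff_aeval hG q
  obtain ⟨G', rfl⟩ := hG
  rw [hq, map_mul, map_pow, Polynomial.aeval_X, mul_pow, mul_assoc, coeff_X_pow_mul', if_pos le_rfl,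
    Nat.sub_self, coeff_zero_eq_constantCoeff_apply, map_mul, map_pow, hc, hq0,
    show coeff 1 (X * G') = constantCoeff G' from by simp]

lemma coeff_aeval_trunc_of_X_dvd (hG : X ∣ G) {h N : ℕ} (hF : X ^ h ∣ F) (hh : 1 ≤ h)
    (hN : 1 < N) :
    coeff h (Polynomial.aeval F (trunc N G)) = coeff 1 G * coeff h F := by
  have : Polynomial.X ^ 2 ∣ trunc N G - Polynomial.C (coeff 1 G) * Polynomial.X := by
    rw [Polynomial.X_pow_dvd_iff]
    intro d hd
    interval_cases d
    · simp [coeff_trunc, X_dvd_iff.mp hG]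
    · simp [coeff_trunc, hN]
  obtain ⟨r, hr⟩ := this
  rw [sub_eq_iff_eq_add] at hr
  rw [hr, map_add, map_mul, map_pow, map_mul, Polynomial.aeval_X, Polynomial.aeval_C, map_add]
  have : X ^ (h + 1) ∣ F ^ 2 * Polynomial.aeval F r := by
    refine Dvd.dvd.mul_right ((pow_dvd_pow X (by omega : h + 1 ≤ h * 2)).trans ?_) _
    rw [pow_mul]
    exact pow_dvd_pow_of_dvd hF 2
  rw [X_pow_dvd_iff.mp this h (by omega), zero_add, PowerSeries.algebraMap_apply, coeff_C_mul]
  simp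

lemma map_aeval_trunc {A : Type*} [CommRing A] (f : A →+* B) (F G : A⟦X⟧) (N : ℕ) :
    PowerSeries.map f (Polynomial.aeval G (trunc N F)) =
      Polynomial.aeval (PowerSeries.map f G) (trunc N (PowerSeries.map f F)) := by
  rw [trunc_map, Polynomial.aeval_def, Polynomial.aeval_def, Polynomial.hom_eval₂,
    Polynomial.eval₂_map]
  congr 1
  ext a : 1
  simp

end Coeff

/-- Take m to be a primitive root modulo p: m^(h-1) = 1 would force p - 1 to divide h - 1, but 0 < h
- 1 < p - 1. -/
lemma exists_isCoprime_pow_sub (p : ℕ) [Fact p.Prime] :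
    ∃ m : ℕ, ∀ h, 2 ≤ h → h < p → IsCoprime ((m : ℤ) ^ h - m) p := by
  obtain ⟨g, hg⟩ := IsCyclic.exists_generator (α := (ZMod p)ˣ)
  refine ⟨(g : ZMod p).val, fun h h2 hp ↦ ?_⟩
  refine IsCoprime.symm ((Nat.prime_iff_prime_int.mp Fact.out).coprime_iff_not_dvd.mpr fun hd ↦ ?_)
  rw [← ZMod.intCast_zmod_eq_zero_iff_dvd] at hd
  push_cast at hd
  rw [ZMod.natCast_zmod_val, sub_eq_zero] at hd
  have h1 : g ^ (h - 1) = 1 := by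
    apply mul_right_cancel (b := g)
    rw [← pow_succ, one_mul, Nat.sub_add_cancel (by omega)]
    exact Units.ext (by simpa using hd)
  have h3 := orderOf_dvd_of_pow_eq_one h1
  rw [orderOf_eq_card_of_forall_mem_zpowers hg, Nat.card_eq_fintype_card, ZMod.card_units] at h3
  have := Nat.le_of_dvd (by omega) h3
  omega

/-! ### Multiplication by p modulo p -/

section MultSeries

open PowerSeries

variable {A : Type*} [CommRing A] [IsDomain A] [IsLocalRing A] (W : WeierstrassCurve A)
  [W.IsElliptic]

/-- Multiplication by `m` and by `n` commute, up to any given order. -/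
lemma X_pow_dvd_multSeries_comp_sub (m n : ℕ) {N : ℕ} (hN : 2 ≤ N) :
    X ^ N ∣ Polynomial.aeval (multSeries W m) (trunc N (multSeries W n)) -
      Polynomial.aeval (multSeries W n) (trunc N (multSeries W m)) := by
  classical
  let W' := W.map (algebraMap A A⟦X⟧)
  let f := algebraMap A⟦X⟧ (FractionRing A⟦X⟧)
  have hf : Function.Injective f := IsFractionRing.injective _ _
  have hgen := (paramsMem_genericParams W).mono span_X_le_maximalIdeal
  have egen := zwEquation_genericParams W
  have hw : wSeries W ≠ 0 := by
    intro h
    have : X ^ 3 = (0 : A⟦X⟧) := by simpa [ZWEquation, genericParams, h] using egen.symm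
    exact pow_ne_zero 3 X_ne_zero this
  -- Over the fraction field of A⟦X⟧ the generic point is a point of an elliptic curve, and [m][n] =
  -- [n][m] comes from its group law.
  obtain ⟨P, hP⟩ := exists_hasParams (V := W'.map f) (egen.map f)
    ((map_ne_zero_iff f hf).mpr hw)
  have key (k l : ℕ) : HasParams ((l * k) • P)
      ((nsmulParams W' (nsmulParams W' (genericParams W) k) l).map f f) := by
    rw [mul_nsmul']
    exact HasParams.nsmul (paramsMem_nsmulParams hgen k) (hP.nsmul hgen k) l
  have heq : (nsmulParams W' (nsmulParams W' (genericParams W) m) n).1 =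
      (nsmulParams W' (nsmulParams W' (genericParams W) n) m).1 := by
    have h := key n m
    rw [mul_comm] at h
    exact hf (congr_arg Prod.fst ((key m n).eq h))
  have hdvd (k l : ℕ) : X ^ N ∣ (nsmulParams W' (nsmulParams W' (genericParams W) k) l).1 -
      Polynomial.aeval (multSeries W k) (trunc N (multSeries W l)) :=
    (pow_dvd_pow_of_dvd (X_dvd_multSeries W k) N).trans <| Ideal.mem_span_singleton.mp <|
      nsmulParams_fst_sub_mem W (paramsMem_nsmulParams hgen k)
        (zwEquation_nsmulParams hgen egen k) l hN
  have := dvd_sub (hdvd n m) (hdvd m n)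
  rw [heq] at this
  simpa using this

/-- Multiplication by a prime `p` vanishes modulo `p` up to order `p`. -/
lemma coeff_multSeries_mem (p : ℕ) [hp : Fact p.Prime] (h : ℕ) (hh : h < p) :
    coeff h (multSeries W p) ∈ Ideal.span {(p : A)} := by
  induction h using Nat.strong_induction_on with
  | h h ih =>
  rcases Nat.lt_or_ge h 2 with h2 | h2
  · interval_cases h
    · rw [coeff_zero_eq_constantCoeff_apply, X_dvd_iff.mp (X_dvd_multSeries W p)]
      exact zero_mem _
    · rw [coeff_one_multSeries]
      exact Ideal.mem_span_singleton_self _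
  obtain ⟨m, hm⟩ := exists_isCoprime_pow_sub p
  let q := Ideal.Quotient.mk (Ideal.span {(p : A)})
  have hF : X ^ h ∣ PowerSeries.map q (multSeries W p) := by
    rw [X_pow_dvd_iff]
    intro d hd
    rw [coeff_map]
    exact Ideal.Quotient.eq_zero_iff_mem.mpr (ih d hd (hd.trans hh))
  have hG : X ∣ PowerSeries.map q (multSeries W m) := by
    have := _root_.map_dvd (PowerSeries.map q) (X_dvd_multSeries W m)
    rwa [map_X] at this
  have hc := _root_.map_dvd (PowerSeries.map q)
    (X_pow_dvd_multSeries_comp_sub W m p hp.out.two_le)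
  rw [map_pow, map_X, map_sub, map_aeval_trunc, map_aeval_trunc] at hc
  -- Modulo p, the degree h coefficients of [p] ∘ [m] and [m] ∘ [p] are m^h c and m c. Coprimality
  -- of m^h - m and p then puts c in (p).
  have hc := X_pow_dvd_iff.mp hc h hh
  rw [map_sub, coeff_aeval_trunc_of_X_pow_dvd hG hF hh,
    coeff_aeval_trunc_of_X_dvd hG hF (by omega) hp.out.one_lt, coeff_map, coeff_map,
    coeff_one_multSeries, ← map_pow, ← map_mul, ← map_mul, ← map_sub] at hc
  have hc := Ideal.Quotient.eq_zero_iff_mem.mp hc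
  obtain ⟨u, v, huv⟩ := hm h h2 hh
  have huv' := congr_arg (Int.cast : ℤ → A) huv
  push_cast at huv'
  set c := coeff h (multSeries W p)
  rw [show c = u * ((m : A) ^ h * c - m * c) + v * c * p by linear_combination (-c) * huv']
  exact add_mem (Ideal.mul_mem_left _ _ hc)
    (Ideal.mul_mem_left _ _ (Ideal.mem_span_singleton_self _))

/-- The parameter of the `p`-th multiple of a point lies in the ideal generated by `p` and the
`p`-th power of the parameter of the point. -/
lemma nsmulParams_prime_fst_mem (p : ℕ) [hp : Fact p.Prime] {P : A × A}
    (hP : ParamsMem (IsLocalRing.maximalIdeal A) P) (eP : ZWEquation W P) :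
    (nsmulParams W P p).1 ∈ Ideal.span {P.1 ^ p} ⊔ Ideal.span {(p : A)} := by
  have hW : W.map (algebraMap A A) = W := W.map_id
  have h := nsmulParams_fst_sub_mem W hP (by rwa [hW]) p hp.out.two_le
  rw [hW] at h
  rw [← sub_add_cancel (nsmulParams W P p).1
    (Polynomial.aeval P.1 (trunc p (multSeries W p)))]
  -- Truncation at p leaves an error in (z^p); every retained coefficient has degree below p and is
  -- divisible by p.
  refine Submodule.add_mem_sup h ?_
  rw [Polynomial.aeval_def, eval₂_trunc_eq_sum_range]
  exact sum_mem fun i hi ↦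
    Ideal.mul_mem_right _ _ (coeff_multSeries_mem W p i (Finset.mem_range.mp hi))

end MultSeries

/-! ### Smoothness of the reduction -/

section Residue

open WeierstrassCurve IsLocalRing

variable {A : Type*} [CommRing A] [IsLocalRing A] {W : WeierstrassCurve A}

lemma not_mem_maximalIdeal_of_isElliptic [W.IsElliptic] {x y : A}
    (h : W.toAffine.Equation x y) (h₁ : 2 * y + W.a₁ * x + W.a₃ ∈ maximalIdeal A) :
    3 * x ^ 2 + 2 * W.a₂ * x + W.a₄ - W.a₁ * y ∉ maximalIdeal A := by
  intro h₂
  rw [← residue_eq_zero_iff] at h₁ h₂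
  have := Affine.equation_iff_nonsingular.mp (h.map (residue A))
  rw [Affine.nonsingular_iff] at this
  simp only [map_add, map_mul, map_sub, map_pow, map_ofNat] at h₁ h₂
  rcases this.2 with h3 | h3
  · apply h3
    simp only [map_a₁, map_a₂, map_a₄]
    linear_combination -h₂
  · apply h3
    simp only [map_a₁, map_a₃]
    linear_combination h₁

end Residue

/-! ### Integral points and points near the origin over a valuation ring -/

section ValuationRing

open WeierstrassCurve IsLocalRing

variable {A L : Type*} [CommRing A] [IsDomain A] [ValuationRing A] [Field L] [Algebra A L]
  [IsFractionRing A L]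

/-- The point is congruent to the point at infinity: its coordinates `z = -x/y` and `w = -1/y`
lie in the maximal ideal of `A`. -/
def NearOrigin (A : Type*) {L : Type*} [CommRing A] [IsLocalRing A] [Field L] [Algebra A L]
    {V : WeierstrassCurve L} (P : V.toAffine.Point) : Prop :=
  ∃ a : A × A, ParamsMem (maximalIdeal A) a ∧
    HasParams P (a.map (algebraMap A L) (algebraMap A L))

lemma exists_mem_maximalIdeal_eq_inv {x : L} (hx : x ∉ (algebraMap A L).range) :
    ∃ t ∈ maximalIdeal A, algebraMap A L t * x = 1 := by
  have hx0 : x ≠ 0 := by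
    rintro rfl
    exact hx (zero_mem _)
  rcases ValuationRing.isInteger_or_isInteger A x with h | ⟨t, ht⟩
  · exact absurd h hx
  · refine ⟨t, ?_, by rw [ht, inv_mul_cancel₀ hx0]⟩
    rw [mem_maximalIdeal]
    rintro ⟨u, rfl⟩
    refine hx ⟨(u⁻¹ : Aˣ), ?_⟩
    have := congr_arg (algebraMap A L) u.inv_mul
    rw [map_mul, ht, map_one] at this
    field_simp at this
    exact this

/-- An element that is a root of a monic quadratic polynomial over `A` lies in `A`. -/
lemma mem_range_of_quadratic {x b c : L} (hb : b ∈ (algebraMap A L).range)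
    (hc : c ∈ (algebraMap A L).range) (h : x ^ 2 + b * x = c) : x ∈ (algebraMap A L).range := by
  by_contra hx
  obtain ⟨t, -, ht⟩ := exists_mem_maximalIdeal_eq_inv hx
  apply hx
  have : x = c * algebraMap A L t - b := by
    linear_combination (-x - b) * ht + algebraMap A L t * h
  rw [this]
  exact sub_mem (mul_mem hc ⟨t, rfl⟩) hb

variable {W : WeierstrassCurve A} {V : WeierstrassCurve L}

lemma nearOrigin_of_notMem {x y : L}
    {h : (W.map (algebraMap A L)).toAffine.Nonsingular x y} (hx : x ∉ (algebraMap A L).range) :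
    NearOrigin A (Affine.Point.some x y h) := by
  obtain ⟨t, htm, ht⟩ := exists_mem_maximalIdeal_eq_inv hx
  have e := (Affine.equation_iff ..).mp h.1
  simp only [map_a₁, map_a₂, map_a₃, map_a₄, map_a₆] at e
  have hs : y * algebraMap A L t ∉ (algebraMap A L).range := by
    rintro ⟨s, hs⟩
    apply hx
    -- Divide the Weierstrass equation by x² and solve for x, with s = y / x and t = 1 / x. So y / x
    -- is not integral, and z = -x / y and w = z t lie in the maximal ideal.
    refine ⟨s ^ 2 + W.a₁ * s + W.a₃ * s * t - W.a₂ - W.a₄ * t - W.a₆ * t ^ 2, ?_⟩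
    simp only [map_add, map_sub, map_mul, map_pow, hs]
    linear_combination algebraMap A L t ^ 2 * e +
      (x * (x * algebraMap A L t + 1) + algebraMap A L W.a₂ * (x * algebraMap A L t + 1) -
        algebraMap A L W.a₁ * y * algebraMap A L t + algebraMap A L W.a₄ * algebraMap A L t) * ht
  obtain ⟨r, hrm, hr⟩ := exists_mem_maximalIdeal_eq_inv hs
  refine ⟨(-r, -(r * t)), ⟨neg_mem hrm, neg_mem (Ideal.mul_mem_right _ _ hrm)⟩, ?_, ?_⟩
  · simp only [Prod.map_fst, Prod.map_snd, map_neg, map_mul]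
    linear_combination (-algebraMap A L r) * ht
  · simp only [Prod.map_snd, map_neg, map_mul]
    linear_combination -hr

lemma exists_of_not_nearOrigin (hV : W.map (algebraMap A L) = V) {P : V.toAffine.Point}
    (hP : ¬ NearOrigin A P) :
    ∃ (x y : A) (h : V.toAffine.Nonsingular (algebraMap A L x) (algebraMap A L y)),
      P = .some _ _ h := by
  subst hV
  rcases P with _ | ⟨x, y, h⟩
  · exact absurd ⟨0, ParamsMem.zero, Prod.ext (map_zero _) (map_zero _)⟩ hP
  · obtain ⟨x, rfl⟩ : x ∈ (algebraMap A L).range := by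
      by_contra hx
      exact hP (nearOrigin_of_notMem hx)
    have e := (Affine.equation_iff ..).mp h.1
    simp only [map_a₁, map_a₂, map_a₃, map_a₄, map_a₆] at e
    obtain ⟨y, rfl⟩ : y ∈ (algebraMap A L).range :=
      mem_range_of_quadratic (A := A) ⟨W.a₁ * x + W.a₃, rfl⟩
        ⟨x ^ 3 + W.a₂ * x ^ 2 + W.a₄ * x + W.a₆, rfl⟩ (by
          simp only [map_add, map_mul, map_pow]
          linear_combination e)
    exact ⟨x, y, h, rfl⟩

/-- Points with the same reduction differ by a point that reduces to the point at infinity. -/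
lemma nearOrigin_sub_of_congr [DecidableEq L] [W.IsElliptic]
    (hV : W.map (algebraMap A L) = V) {x y x' y' : A}
    (hx : x' - x ∈ maximalIdeal A) (hy : y' - y ∈ maximalIdeal A)
    (h : V.toAffine.Nonsingular (algebraMap A L x) (algebraMap A L y))
    (h' : V.toAffine.Nonsingular (algebraMap A L x') (algebraMap A L y')) :
    NearOrigin A (Affine.Point.some _ _ h' - Affine.Point.some _ _ h) := by
  subst hV
  have hinj : Function.Injective (algebraMap A L) := IsFractionRing.injective A L
  have e := (W.toAffine.map_equation hinj x y).mp h.1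
  have e' := (W.toAffine.map_equation hinj x' y').mp h'.1
  have hns := not_mem_maximalIdeal_of_isElliptic e
  rw [Affine.equation_iff] at e e'
  rw [sub_eq_add_neg, Affine.Point.neg_some]
  by_cases hxy : algebraMap A L x' = algebraMap A L x ∧ algebraMap A L y' =
      (W.map (algebraMap A L)).toAffine.negY (algebraMap A L x)
        ((W.map (algebraMap A L)).toAffine.negY (algebraMap A L x) (algebraMap A L y))
  · rw [Affine.Point.add_of_Y_eq hxy.1 hxy.2]
    exact ⟨0, ParamsMem.zero, Prod.ext (map_zero _) (map_zero _)⟩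
  rw [Affine.Point.add_some hxy]
  refine nearOrigin_of_notMem fun hX ↦ ?_
  set l := (W.map (algebraMap A L)).toAffine.slope (algebraMap A L x') (algebraMap A L x)
    (algebraMap A L y')
    ((W.map (algebraMap A L)).toAffine.negY (algebraMap A L x) (algebraMap A L y)) with hl
  -- The addition formula makes the slope a root of l² + a₁ l = X + a₂ + x' + x, which is monic with
  -- integral coefficients.
  obtain ⟨k, hk⟩ : l ∈ (algebraMap A L).range := by
    obtain ⟨X, hX⟩ := hX
    refine mem_range_of_quadratic (A := A) ⟨W.a₁, rfl⟩ ⟨X + W.a₂ + x' + x, rfl⟩ ?_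
    simp only [map_add, hX, Affine.addX, map_a₁, map_a₂]
    ring
  rw [← hk] at hl
  -- In either case the slope equation, and for x' ≠ x also the difference of the curve equations
  -- divided by x' - x, expresses both partial derivatives as combinations of x' - x and y' - y.
  by_cases hxx : x' = x
  · subst hxx
    rw [Affine.negY_negY] at hxy
    have hyy : y' ≠ y := fun h0 ↦ hxy ⟨rfl, by rw [h0]⟩
    have hne : algebraMap A L y' ≠ (W.map (algebraMap A L)).toAffine.negY (algebraMap A L x')
        ((W.map (algebraMap A L)).toAffine.negY (algebraMap A L x') (algebraMap A L y)) := by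
      rw [Affine.negY_negY]
      exact fun h0 ↦ hyy (hinj h0)
    have hy' := Affine.Y_eq_of_Y_ne h'.1 ((Affine.equation_neg _ _).mpr h.1) rfl hne
    have hy'' : y' = -y - W.a₁ * x' - W.a₃ := by
      apply hinj
      rw [hy']
      simp [Affine.negY]
    have hyneg : (W.map (algebraMap A L)).toAffine.negY (algebraMap A L x') (algebraMap A L y') =
        algebraMap A L y := by
      rw [hy', Affine.negY_negY]
    rw [Affine.slope_of_Y_ne rfl hne, hyneg,
      eq_div_iff (sub_ne_zero.mpr fun h0 ↦ hyy (hinj h0))] at hl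
    have hl' : k * (y' - y) = 3 * x' ^ 2 + 2 * W.a₂ * x' + W.a₄ - W.a₁ * y' := by
      apply hinj
      simpa [map_ofNat] using hl
    refine hns ?_ ?_
    · rw [show 2 * y + W.a₁ * x' + W.a₃ = -(y' - y) by rw [hy'']; ring]
      exact neg_mem hy
    · rw [show 3 * x' ^ 2 + 2 * W.a₂ * x' + W.a₄ - W.a₁ * y = (k + W.a₁) * (y' - y) by
        linear_combination -hl']
      exact Ideal.mul_mem_left _ _ hy
  · rw [Affine.slope_of_X_ne (fun h0 ↦ hxx (hinj h0)),
      eq_div_iff (sub_ne_zero.mpr fun h0 ↦ hxx (hinj h0))] at hl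
    have hl' : k * (x' - x) = y' + y + W.a₁ * x + W.a₃ := by
      apply hinj
      simp only [map_mul, map_sub, hl, Affine.negY, map_add, map_a₁, map_a₃]
      ring
    have hU : (y' - y) * (k + W.a₁) =
        x' ^ 2 + x' * x + x ^ 2 + W.a₂ * (x + x') + W.a₄ - W.a₁ * y := by
      apply mul_left_cancel₀ (sub_ne_zero.mpr hxx)
      linear_combination (y' - y) * hl' + e' - e
    refine hns ?_ ?_
    · rw [show 2 * y + W.a₁ * x + W.a₃ = k * (x' - x) - (y' - y) by linear_combination -hl']
      exact sub_mem (Ideal.mul_mem_left _ _ hx) hy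
    · rw [show 3 * x ^ 2 + 2 * W.a₂ * x + W.a₄ - W.a₁ * y =
        (k + W.a₁) * (y' - y) - (x' + 2 * x + W.a₂) * (x' - x) by linear_combination -hU]
      exact sub_mem (Ideal.mul_mem_left _ _ hy) (Ideal.mul_mem_left _ _ hx)

end ValuationRing

/-! ### Differences of points near the origin and their p-th multiples -/

section Sub

open WeierstrassCurve IsLocalRing

variable {A L : Type*} [CommRing A] [IsLocalRing A] [Field L] [Algebra A L] [DecidableEq L]
  {W : WeierstrassCurve A} {V : WeierstrassCurve L}

lemma HasParams.sub (hV : W.map (algebraMap A L) = V) {P Q : V.toAffine.Point} {a b : A × A}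
    (ha : ParamsMem (maximalIdeal A) a) (hb : ParamsMem (maximalIdeal A) b)
    (hP : HasParams P (a.map (algebraMap A L) (algebraMap A L)))
    (hQ : HasParams Q (b.map (algebraMap A L) (algebraMap A L))) :
    HasParams (P - Q)
      ((addParams W a (negParams W b)).map (algebraMap A L) (algebraMap A L)) := by
  subst hV
  have hn := isUnit_negDen (W := W) hb
  have hadd := addable_of_mem (W := W) ha (paramsMem_negParams (W := W) hb)
  rw [sub_eq_add_neg, map_addParams _ hadd]
  refine hP.add ?_ (hadd.map _)
  rw [map_negParams _ hn]
  exact hQ.neg (by rw [← map_negDen]; exact hn.map _)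

/-- The parameter of the difference of two points is a multiple of the difference of
their parameters. -/
lemma sub_fst_dvd_fst {P Q : (W.map (algebraMap A L)).toAffine.Point}
    (hinj : Function.Injective (algebraMap A L)) {a b d : A × A} (hb : ParamsMem (maximalIdeal A) b)
    (hd : ParamsMem (maximalIdeal A) d)
    (hP : HasParams P (a.map (algebraMap A L) (algebraMap A L)))
    (hQ : HasParams Q (b.map (algebraMap A L) (algebraMap A L)))
    (hD : HasParams (P - Q) (d.map (algebraMap A L) (algebraMap A L))) :
    a.1 - b.1 ∣ d.1 := by
  have hadd := addable_of_mem (W := W) hb hd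
  have h := hQ.add hD (hadd.map _)
  rw [add_sub_cancel, ← map_addParams _ hadd] at h
  have hab : addParams W b d = a := (Prod.map_injective.mpr ⟨hinj, hinj⟩) (h.eq hP)
  have hm := addParams_fst_sub_mem le_rfl hb hd (hQ.zwEquation.of_map hinj)
    (hD.zwEquation.of_map hinj)
  -- Membership gives a.1 - b.1 = d.1 * (1 + e) with e in the maximal ideal.
  rw [hab, Ideal.mem_span_singleton_mul] at hm
  obtain ⟨e, he, hde⟩ := hm
  have hu : IsUnit (1 + e) := isUnit_of_one_sub_mem (by simpa using he)
  rw [← hu.dvd_mul_right]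
  exact dvd_of_eq (by linear_combination -hde)

lemma prime_nsmul_sub [IsDomain A] [W.IsElliptic] (p : ℕ) [hp : Fact p.Prime]
    (hinj : Function.Injective (algebraMap A L)) (hV : W.map (algebraMap A L) = V)
    {P Q : V.toAffine.Point} {a b : A × A}
    (ha : ParamsMem (maximalIdeal A) a) (hb : ParamsMem (maximalIdeal A) b)
    (hP : HasParams P (a.map (algebraMap A L) (algebraMap A L)))
    (hQ : HasParams Q (b.map (algebraMap A L) (algebraMap A L))) :
    ∃ c : A × A, ParamsMem (maximalIdeal A) c ∧
      HasParams (p • (P - Q)) (c.map (algebraMap A L) (algebraMap A L)) ∧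
      c.1 ∈ Ideal.span {a.1 ^ p - b.1 ^ p} ⊔ Ideal.span {(p : A)} := by
  subst hV
  have hD := HasParams.sub rfl ha hb hP hQ
  set d := addParams W a (negParams W b)
  have hd : ParamsMem (maximalIdeal A) d := paramsMem_addParams ha (paramsMem_negParams hb)
  refine ⟨nsmulParams W d p, paramsMem_nsmulParams hd p, hD.nsmul hd p, ?_⟩
  have hdvd := sub_fst_dvd_fst hinj hb hd hP hQ hD
  refine (sup_le ?_ le_sup_right : _ ≤ Ideal.span {a.1 ^ p - b.1 ^ p} ⊔ Ideal.span {(p : A)})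
    (nsmulParams_prime_fst_mem W p hd (hD.zwEquation.of_map hinj))
  rw [Ideal.span_singleton_le_iff_mem]
  refine Ideal.mem_of_dvd _ (pow_dvd_pow_of_dvd hdvd p) ?_
  -- The binomial theorem for (a.1 - b.1) + b.1: the p-th power of a difference is the difference of
  -- the p-th powers modulo p.
  obtain ⟨r, hr⟩ := exists_add_pow_prime_eq hp.out (a.1 - b.1) b.1
  rw [sub_add_cancel] at hr
  rw [show (a.1 - b.1) ^ p = (a.1 ^ p - b.1 ^ p) + (-((a.1 - b.1) * b.1 * r)) * p by
    linear_combination -hr]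
  exact Submodule.add_mem_sup (Ideal.mem_span_singleton_self _)
    (Ideal.mul_mem_left _ _ (Ideal.mem_span_singleton_self _))

end Sub

/-! ### Inertia and valuation rings -/

section LocalField

variable {K L : Type*} [Field K] [Field L] [ValuativeRel L] [Algebra K L]

/-- An element of the inertia group moves every integral element by an element of the maximal
ideal. -/
lemma exists_sub_mem_of_mem_inertiaGroup {τ : L ≃ₐ[K] L} (hτ : τ ∈ inertiaGroup K L) (x : 𝒪[L]) :
    ∃ y : 𝒪[L], (y : L) = τ x ∧ y - x ∈ IsLocalRing.maximalIdeal 𝒪[L] := by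
  obtain ⟨σ, hσ, rfl⟩ := hτ
  let x' : (valuation L).valuationSubring := ⟨x, x.2⟩
  have h := congr_arg (fun f : RingAut _ ↦ f (IsLocalRing.residue _ x')) (MonoidHom.mem_ker.mp hσ)
  have h : IsLocalRing.residue _ (σ • x') = IsLocalRing.residue _ x' := h
  rw [← sub_eq_zero, ← map_sub, IsLocalRing.residue_eq_zero_iff] at h
  refine ⟨⟨(σ • x' : (valuation L).valuationSubring), (σ • x').2⟩, rfl, ?_⟩
  exact h

/-- The inclusion of the valuation ring of `K` into that of `L`. -/
def integerMap (K L : Type*) [Field K] [Field L] [ValuativeRel K] [ValuativeRel L] [Algebra K L]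
    [ValuativeExtension K L] : 𝒪[K] →+* 𝒪[L] :=
  ((algebraMap K L).comp (algebraMap 𝒪[K] K)).codRestrict 𝒪[L] fun x ↦ by
    have h : (x : K) ≤ᵥ 1 := ((valuation K).vle_one_iff).mpr x.2
    rw [← ValuativeExtension.vle_iff_vle (B := L), map_one] at h
    exact ((valuation L).vle_one_iff).mp h

lemma algebraMap_comp_integerMap [ValuativeRel K] [ValuativeExtension K L] :
    (algebraMap 𝒪[L] L).comp (integerMap K L) = (algebraMap K L).comp (algebraMap 𝒪[K] K) :=
  rfl

end LocalField

/-! ### The kernel of reduction in terms of z and w -/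

section Reduction

open WeierstrassCurve IsLocalRing

variable {L : Type*} [Field L] [ValuativeRel L]

/-- Reduction to [0 : 1 : 0] makes v₁ a unit and puts v₀, v₂ in the maximal ideal, so z = -v₀ / v₁
and w = -v₂ / v₁ work. Conversely the point is [-z : 1 : -w]. -/
lemma mem_kernelOfReduction_iff {V : WeierstrassCurve L} {P : V.toAffine.Point} :
    P ∈ kernelOfReduction V ↔ NearOrigin 𝒪[L] P := by
  constructor
  · rintro ⟨v, -, hv, hr⟩
    obtain ⟨u, hu⟩ := Quotient.exact hr
    have hr0 : residue 𝒪[L] (v 0) = 0 := by simpa using (congr_fun hu 0).symm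
    have hr1 : residue 𝒪[L] (v 1) ≠ 0 := by
      rw [← congr_fun hu 1]
      simp [Units.smul_def]
    have hr2 : residue 𝒪[L] (v 2) = 0 := by simpa using (congr_fun hu 2).symm
    rw [residue_eq_zero_iff] at hr0 hr2
    rw [residue_ne_zero_iff_isUnit] at hr1
    obtain ⟨i, hi⟩ := hr1.exists_right_inv
    have hi' : (v 1 : L) * (i : L) = 1 := congr_arg Subtype.val hi
    rcases P with _ | ⟨x, y, h⟩
    · exact ⟨0, ParamsMem.zero, rfl⟩
    · obtain ⟨c, hc⟩ := Quotient.exact hv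
      have h0 : (c : L) * x = v 0 := congr_fun hc 0
      have h1 : (c : L) * y = v 1 := congr_fun hc 1
      have h2 : (c : L) * 1 = v 2 := congr_fun hc 2
      refine ⟨(-(v 0 * i), -(v 2 * i)), ⟨neg_mem (Ideal.mul_mem_right _ _ hr0),
        neg_mem (Ideal.mul_mem_right _ _ hr2)⟩, ?_, ?_⟩
      · show x * -((v 2 : L) * i) = -((v 0 : L) * i)
        rw [← h0, ← h2]
        ring
      · show y * -((v 2 : L) * i) = -1
        rw [← h2]
        rw [← h1] at hi'
        linear_combination -hi'
  · rintro ⟨a, ⟨ha1, ha2⟩, hP⟩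
    rcases P with _ | ⟨x, y, h⟩
    · refine ⟨![0, 1, 0], ⟨1, isUnit_one⟩, ?_, ?_⟩
      · refine congr_arg _ ?_
        ext i
        fin_cases i <;> rfl
      · refine congr_arg _ ?_
        ext i
        fin_cases i <;> simp
    · have h1 : x * (a.2 : L) = a.1 := hP.1
      have h2 : y * (a.2 : L) = -1 := hP.2
      have hy : y ≠ 0 := by
        rintro rfl
        simp at h2
      refine ⟨![-a.1, 1, -a.2], ⟨1, isUnit_one⟩, ?_, ?_⟩
      · refine Eq.symm (Quotient.sound ⟨Units.mk0 y hy, ?_⟩)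
        ext i
        fin_cases i
        · show y * -(a.1 : L) = x
          rw [← h1]
          linear_combination -x * h2
        · exact mul_one y
        · show y * -(a.2 : L) = 1
          linear_combination -h2
      · refine congr_arg _ ?_
        ext i
        rw [← residue_eq_zero_iff] at ha1 ha2
        fin_cases i <;> simp [ha1, ha2]

end Reduction

/-! ### Assembling both statements -/

section Main

open WeierstrassCurve IsLocalRing

/-- The base change to `L` of a minimal equation with good reduction comes from an elliptic
curve over the valuation ring of `L`. -/
lemma exists_isElliptic_integralModel {K L : Type*} [Field K] [ValuativeRel K]
    [TopologicalSpace K] [IsNonarchimedeanLocalField K] [Field L] [ValuativeRel L] [Algebra K L]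
    [ValuativeExtension K L] (W : WeierstrassCurve K) [hW : W.HasGoodReduction 𝒪[K]] :
    ∃ W₀ : WeierstrassCurve 𝒪[L], W₀.IsElliptic ∧
      W₀.map (algebraMap 𝒪[L] L) = W.baseChange L := by
  refine ⟨(W.integralModel 𝒪[K]).map (integerMap K L), ?_, ?_⟩
  · have h := (hasGoodReduction_iff_isElliptic_reduction 𝒪[K]).mp hW
    rw [isElliptic_iff, reduction, map_Δ, isUnit_iff_ne_zero,
      residue_ne_zero_iff_isUnit] at h
    rw [isElliptic_iff, map_Δ]
    exact h.map _
  · rw [WeierstrassCurve.map_map, algebraMap_comp_integerMap, ← WeierstrassCurve.map_map]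
    exact congr_arg (WeierstrassCurve.map · (algebraMap K L)) (W.baseChange_integralModel_eq 𝒪[K])

variable {K L : Type*} [Field K] [Field L] [ValuativeRel L] [Algebra K L] [DecidableEq L]
  {W : WeierstrassCurve K} {W₀ : WeierstrassCurve 𝒪[L]}

/-- The parameters of τP are τz and τw, which differ from z and w by elements of the maximal ideal
and so stay in it. -/
lemma exists_hasParams_map {τ : L ≃ₐ[K] L} (hτ : τ ∈ inertiaGroup K L)
    {P : (W.baseChange L).toAffine.Point} {a : 𝒪[L] × 𝒪[L]}
    (ha : ParamsMem (maximalIdeal 𝒪[L]) a)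
    (hP : HasParams P (a.map (algebraMap 𝒪[L] L) (algebraMap 𝒪[L] L))) :
    ∃ b : 𝒪[L] × 𝒪[L], ParamsMem (maximalIdeal 𝒪[L]) b ∧ (b.1 : L) = τ a.1 ∧
      HasParams (Affine.Point.map (τ : L →ₐ[K] L) P)
        (b.map (algebraMap 𝒪[L] L) (algebraMap 𝒪[L] L)) := by
  obtain ⟨z', hz, hzm⟩ := exists_sub_mem_of_mem_inertiaGroup hτ a.1
  obtain ⟨w', hw, hwm⟩ := exists_sub_mem_of_mem_inertiaGroup hτ a.2
  refine ⟨(z', w'), ⟨by simpa using add_mem hzm ha.1, by simpa using add_mem hwm ha.2⟩, hz, ?_⟩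
  rcases P with _ | ⟨x, y, h⟩
  · have h0 := Prod.ext_iff.mp (show a.map _ _ = 0 from hP)
    have h1 : (a.1 : L) = 0 := h0.1
    have h2 : (a.2 : L) = 0 := h0.2
    rw [h1, map_zero] at hz
    rw [h2, map_zero] at hw
    exact Prod.ext hz hw
  · have h1 : x * (a.2 : L) = a.1 := hP.1
    have h2 : y * (a.2 : L) = -1 := hP.2
    constructor
    · show τ x * (w' : L) = z'
      rw [hz, hw, ← map_mul, h1]
    · show τ y * (w' : L) = -1
      rw [hw, ← map_mul, h2, map_neg, map_one]

lemma map_sub_mem_kernelOfReduction [W₀.IsElliptic]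
    (hW : W₀.map (algebraMap 𝒪[L] L) = W.baseChange L) {τ : L ≃ₐ[K] L}
    (hτ : τ ∈ inertiaGroup K L) (P : (W.baseChange L).toAffine.Point) :
    Affine.Point.map (τ : L →ₐ[K] L) P - P ∈ kernelOfReduction (W.baseChange L) := by
  rw [mem_kernelOfReduction_iff]
  -- Near the origin, closure under subtraction suffices; away from it the coordinates are integral
  -- and congruent to their images under τ.
  by_cases hP : NearOrigin 𝒪[L] P
  · obtain ⟨a, ha, hPa⟩ := hP
    obtain ⟨b, hb, -, hPb⟩ := exists_hasParams_map hτ ha hPa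
    exact ⟨_, paramsMem_addParams hb (paramsMem_negParams ha), HasParams.sub hW hb ha hPb hPa⟩
  · obtain ⟨x, y, h, rfl⟩ := exists_of_not_nearOrigin hW hP
    obtain ⟨x', hx, hxm⟩ := exists_sub_mem_of_mem_inertiaGroup hτ x
    obtain ⟨y', hy, hym⟩ := exists_sub_mem_of_mem_inertiaGroup hτ y
    have hmap : ∃ h', Affine.Point.map (τ : L →ₐ[K] L) (.some _ _ h) =
        (.some (algebraMap 𝒪[L] L x') (algebraMap 𝒪[L] L y') h' :
          (W.baseChange L).toAffine.Point) := by
      rw [show algebraMap 𝒪[L] L x' = τ x from hx, show algebraMap 𝒪[L] L y' = τ y from hy]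
      exact ⟨_, rfl⟩
    obtain ⟨h', hmap⟩ := hmap
    rw [hmap]
    exact nearOrigin_sub_of_congr hW hxm hym h h'

lemma prime_nsmul_map_sub [W₀.IsElliptic] (p : ℕ) [Fact p.Prime]
    (hW : W₀.map (algebraMap 𝒪[L] L) = W.baseChange L) {τ : L ≃ₐ[K] L}
    (hτ : τ ∈ inertiaGroup K L) {Q : (W.baseChange L).toAffine.Point}
    (hQ : Q ∈ kernelOfReduction (W.baseChange L)) :
    p • (Affine.Point.map (τ : L →ₐ[K] L) Q - Q) ∈ kernelOfReduction (W.baseChange L) ∧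
      z (p • (Affine.Point.map (τ : L →ₐ[K] L) Q - Q)) ∈
        Submodule.span 𝒪[L] {τ (z Q) ^ p - z Q ^ p} ⊔ Submodule.span 𝒪[L] {(p : L)} := by
  rw [mem_kernelOfReduction_iff] at hQ ⊢
  obtain ⟨a, ha, hQa⟩ := hQ
  obtain ⟨b, hb, hba, hQb⟩ := exists_hasParams_map hτ ha hQa
  have hz : z Q = (a.1 : L) := hQa.z_eq
  rw [hz, ← hba]
  obtain ⟨c, hc, hQc, hmem⟩ :=
    prime_nsmul_sub p (IsFractionRing.injective 𝒪[L] L) hW hb ha hQb hQa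
  refine ⟨⟨c, hc, hQc⟩, ?_⟩
  rw [hQc.z_eq]
  obtain ⟨u, hu, v, hv, huv⟩ := Submodule.mem_sup.mp hmem
  obtain ⟨r, rfl⟩ := Ideal.mem_span_singleton'.mp hu
  obtain ⟨s, rfl⟩ := Ideal.mem_span_singleton'.mp hv
  rw [Prod.map_fst, ← huv, map_add]
  refine Submodule.add_mem_sup (Submodule.mem_span_singleton.mpr ⟨r, ?_⟩)
    (Submodule.mem_span_singleton.mpr ⟨s, ?_⟩)
  · rw [Algebra.smul_def, map_mul, map_sub, map_pow, map_pow]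
    rfl
  · rw [Algebra.smul_def, map_mul, map_natCast]

end Main

end LocalCurve

end

/-- `K/ℚ_p` is a local field, `W` is a minimal Weierstrass equation over `K` with good reduction,
`L/K` is a finite ramified Galois extension and `τ` lies in its inertia group. -/
theorem mainTheorem6 (p : ℕ) [Fact p.Prime]
    (K : Type*) [Field K] [ValuativeRel K] [TopologicalSpace K] [IsNonarchimedeanLocalField K]
    [Algebra ℚ_[p] K] [ValuativeExtension ℚ_[p] K] [FiniteDimensional ℚ_[p] K]
    (L : Type*) [Field L] [ValuativeRel L] [TopologicalSpace L] [IsNonarchimedeanLocalField L]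
    [DecidableEq L]
    [Algebra K L] [ValuativeExtension K L] [FiniteDimensional K L] [IsGalois K L]
    (hram : LocalCurve.IsRamified K L)
    (W : WeierstrassCurve K) [W.IsElliptic] [W.HasGoodReduction 𝒪[K]]
    (τ : L ≃ₐ[K] L) (hτ : τ ∈ LocalCurve.inertiaGroup K L) :
    (∀ P : (W.baseChange L).toAffine.Point,
      WeierstrassCurve.Affine.Point.map (τ : L →ₐ[K] L) P - P ∈
        LocalCurve.kernelOfReduction (W.baseChange L)) ∧
    (∀ Q ∈ LocalCurve.kernelOfReduction (W.baseChange L),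
      p • (WeierstrassCurve.Affine.Point.map (τ : L →ₐ[K] L) Q - Q) ∈
          LocalCurve.kernelOfReduction (W.baseChange L) ∧
      LocalCurve.z (p • (WeierstrassCurve.Affine.Point.map (τ : L →ₐ[K] L) Q - Q)) ∈
        Submodule.span 𝒪[L] {τ (LocalCurve.z Q) ^ p - LocalCurve.z Q ^ p} ⊔
          Submodule.span 𝒪[L] {(p : L)}) := by
  obtain ⟨W₀, hW₀, hW⟩ := LocalCurve.exists_isElliptic_integralModel (L := L) W
  exact ⟨LocalCurve.map_sub_mem_kernelOfReduction hW hτ,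
    fun Q hQ ↦ LocalCurve.prime_nsmul_map_sub p hW hτ hQ⟩
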